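/- Let $T>0$. For $N=1,2,\dots$ put $\Delta t=T/N$, let $\mu^N$ be the law $N(0,\Delta t\, I)$ on $\mathbb{R}^N$, let $\Delta W_1,\dots,\Delta W_N$ be the coordinates, and $\mathcal{G}^N_l=\sigma(\Delta W_1,\dots,\Delta W_l)$. Let $H_m(x)=\frac{(-1)^m}{\sqrt{m!}}e^{x^2/2}\frac{d^m}{dx^m}e^{-x^2/2}$ and $H_k^N=\prod_{i=1}^N H_{k_i}(\Delta W_i/\sqrt{\Delta t})$ for $k\in\mathbb{Z}_+^N$, $|k|=k_1+\dots+k_N$. A generalized functional $X$ of the increments is given by its generalized expectations $E[XP]$ against polynomials $P$ in the increments; put $J_nX=\sum_{|k|=n}E[XH^N_k]H^N_k$, $\|X\|_{2,s}^2=\sum_{n\ge 0}(1+n)^s\|J_nX\|_{L^2(\mu^N)}^2$, $\mathbb{D}^{(N)}_{2,s}=\{X:\|X\|_{2,s}<\infty\}$ (the completion of $L^2(\mu^N)$ under $\|\cdot\|_{2,s}$ if $s\le 0$), and $\mathbb{D}^{(N)}_{2,-\infty}=\bigcup_{s<0}\mathbb{D}^{(N)}_{2,s}$. Partial derivatives are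 taken in the distribution sense, i.e. $E[(\partial_lX)P]=E[X(\tfrac{\Delta W_l}{\Delta t}P-\partial_lP)]$, and $E[X|\mathcal{G}^N_{l}]$ is the $\mathcal{G}^N_{l}$-measurable $Y$ with $E[XZ]=E[YZ]$ for all polynomials $Z$ in $\Delta W_1,\dots,\Delta W_l$. Let $0\le s\le 1$ and let $F^N\in\mathbb{D}^{(N)}_{2,-\infty}$, $N=1,2,\dots$, satisfy $\sup_N\|F^N\|_{2,s}<\infty$ and the finite-dimensional property $$\sup_{k_1+\dots+k_N=n}\big(E[\partial_1^{k_1}\cdots\partial_N^{k_N}F^N]\big)^2=O\Big(\frac{n!\,\|J_nF^N\|_{L^2}^2}{T^n}\Big)\quad\text{uniformly in } n=2,3,\dots\text{ as }N\to\infty .$$ Then, for every $N\geq 1$, $F^N$ and all $E[\partial_lF^N|\mathcal{G}^N_{l-1}]$ are in $L^2(\mu^N)$, and the first-order martingale representation error $$\text{1-Mart.Err}(F^N)=F^N-E[F^N]-\sum_{l=1}^N E[\partial_lF^N|\mathcal{G}^N_{l-1}]\,\Delta W_l$$ satisfies, for some constant $C$ independent of $N$, $$\|\text{1-Mart.Err}(F^N)\|_{L^2}^2\le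 C\,N^{-s}\quad\text{for all }N\ge1,$$ so that $\|\text{1-Mart.Err}(F^N)\|_{L^2}=O(N^{-s/2})$ as $N\to\infty$. -/

import Mathlib

open MeasureTheory ProbabilityTheory
open scoped NNReal ENNReal

namespace DiscreteWiener

noncomputable section

/-- The law `μ^N = N(0, δ I)` on `ℝ^N` of the increments `(ΔW_1, …, ΔW_N)`, where `δ = Δt`.
The coordinate map `x ↦ x l` plays the role of `ΔW_{l+1}`. -/
def wienerMeasure (N : ℕ) (δ : ℝ≥0) : Measure (Fin N → ℝ) :=
  Measure.pi fun _ => gaussianReal 0 δ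

/-- Generalized functionals of the increments, as linear functionals on the space of polynomials
in the increments: `X P` is the generalized expectation `E[X P]`. The space of polynomials is
dense in every Sobolev space over `μ^N`, so an element of any of these spaces is determined by
its values on polynomials; the Sobolev spaces are carved out by `sobolevNormSq` below. -/
abbrev GenFunctional (N : ℕ) : Type := Module.Dual ℝ (MvPolynomial (Fin N) ℝ)

/-- The generalized expectation `E[X]`. -/
def expect {N : ℕ} (X : GenFunctional N) : ℝ := X 1

/-- The Gaussian adjoint `P ↦ (x_l / δ) P - ∂_l P` of the partial derivative: for the density
`p` of `μ^N` one has `-∂_l (P p) = ((x_l / δ) P - ∂_l P) p`. -/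
def derivAdjoint {N : ℕ} (δ : ℝ≥0) (l : Fin N) :
    MvPolynomial (Fin N) ℝ →ₗ[ℝ] MvPolynomial (Fin N) ℝ :=
  LinearMap.mulLeft ℝ (MvPolynomial.C ((δ : ℝ)⁻¹) * MvPolynomial.X l) -
    (MvPolynomial.pderiv l).toLinearMap

/-- The distributional partial derivative `∂_l`, characterized by
`⟨∂_l X, P p⟩ = - ⟨X, ∂_l (P p)⟩`. -/
def partialDeriv {N : ℕ} (δ : ℝ≥0) (l : Fin N) : Module.End ℝ (GenFunctional N) :=
  (derivAdjoint δ l).dualMap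

/-- The mixed derivative `∂_1^{k_1} ⋯ ∂_N^{k_N}`. -/
def mixedDeriv {N : ℕ} (δ : ℝ≥0) (k : Fin N → ℕ) : Module.End ℝ (GenFunctional N) :=
  ((List.finRange N).map fun l => partialDeriv δ l ^ k l).prod

/-- The product `∏ i, H_{k_i}(x_i / √δ)` of normalized Hermite polynomials
`H_m = (-1)^m / √(m!) · e^{x²/2} (d/dx)^m e^{-x²/2}`. -/
def hermiteProd {N : ℕ} (δ : ℝ≥0) (k : Fin N → ℕ) : MvPolynomial (Fin N) ℝ :=
  ∏ i, MvPolynomial.C ((Real.sqrt ((k i).factorial : ℝ))⁻¹) *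
    Polynomial.aeval (MvPolynomial.C ((Real.sqrt (δ : ℝ))⁻¹) * MvPolynomial.X i)
      (Polynomial.hermite (k i))

/-- The component `J_n X` of `X` in the `n`-th chaos. -/
def chaosProj {N : ℕ} (δ : ℝ≥0) (n : ℕ) (X : GenFunctional N) : MvPolynomial (Fin N) ℝ :=
  ∑ k ∈ Finset.piAntidiag (Finset.univ : Finset (Fin N)) n, X (hermiteProd δ k) • hermiteProd δ k

/-- `‖J_n X‖²`, the squared norm in `L²(μ^N)`. -/
def chaosNormSq {N : ℕ} (δ : ℝ≥0) (n : ℕ) (X : GenFunctional N) : ℝ :=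
  ∫ x, (MvPolynomial.eval x (chaosProj δ n X)) ^ 2 ∂wienerMeasure N δ

/-- `‖X‖²_{2,s} = ∑ n, (1+n)^s ‖J_n X‖²`, possibly infinite. -/
def sobolevNormSq {N : ℕ} (δ : ℝ≥0) (s : ℝ) (X : GenFunctional N) : ℝ≥0∞ :=
  ∑' n : ℕ, ENNReal.ofReal ((1 + (n : ℝ)) ^ s * chaosNormSq δ n X)

/-- The Sobolev space `𝔻_{2,s}` over `μ^N`. -/
def sobolevSpace (N : ℕ) (δ : ℝ≥0) (s : ℝ) : Set (GenFunctional N) :=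
  {X | sobolevNormSq δ s X < ∞}

/-- `𝔻_{2,-∞} = ⋃_{s<0} 𝔻_{2,s}`. -/
def sobolevSpaceNegInf (N : ℕ) (δ : ℝ≥0) : Set (GenFunctional N) :=
  ⋃ s ∈ Set.Iio (0 : ℝ), sobolevSpace N δ s

/-- The generalized functional `X` is the function `f ∈ L²(μ^N)`. -/
def IsRepresentedBy {N : ℕ} (δ : ℝ≥0) (X : GenFunctional N) (f : (Fin N → ℝ) → ℝ) : Prop :=
  MemLp f 2 (wienerMeasure N δ) ∧
    ∀ P : MvPolynomial (Fin N) ℝ, X P = ∫ x, f x * MvPolynomial.eval x P ∂wienerMeasure N δ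

/-- The sigma-algebra generated by the coordinates `i < l` (the increments preceding the one
indexed by `l`). -/
abbrev pastSigma {N : ℕ} (l : Fin N) : MeasurableSpace (Fin N → ℝ) :=
  ⨆ i : {i : Fin N // i < l}, MeasurableSpace.comap (fun x => x i) inferInstance

/-- `Y` is the (generalized) conditional expectation of `X` given the increments preceding the
one indexed by `l`, and is square integrable: `Y` is measurable in the past and
`E[X Z] = E[Y Z]` for every test function `Z` of the past. -/
def IsCondExpPast {N : ℕ} (δ : ℝ≥0) (X : GenFunctional N) (l : Fin N)
    (Y : (Fin N → ℝ) → ℝ) : Prop :=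
  Measurable[pastSigma l] Y ∧ MemLp Y 2 (wienerMeasure N δ) ∧
    ∀ P ∈ MvPolynomial.supported ℝ {i : Fin N | i < l},
      X P = ∫ x, Y x * MvPolynomial.eval x P ∂wienerMeasure N δ

/-- `e` is a version of the first order martingale representation error
`X - E[X] - ∑ l, E[∂_l X | past of l] ΔW_l`. -/
def IsFirstMartErr {N : ℕ} (δ : ℝ≥0) (X : GenFunctional N) (e : (Fin N → ℝ) → ℝ) : Prop :=
  ∃ (f : (Fin N → ℝ) → ℝ) (Y : Fin N → (Fin N → ℝ) → ℝ),
    IsRepresentedBy δ X f ∧ (∀ l, IsCondExpPast δ (partialDeriv δ l X) l (Y l)) ∧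
      e =ᵐ[wienerMeasure N δ] fun x => f x - expect X - ∑ l, Y l x * x l

/-- The finite-dimensional property of a sequence `F^N` of functionals of the `N` increments with
step `Δt = T / N`: uniformly in `n = 2, 3, …` as `N → ∞`,
`sup_{|k| = n} E[∂^k F^N]² = O(n! ‖J_n F^N‖² / T^n)`. -/
def FiniteDimensionalProperty (T : ℝ≥0) (F : (N : ℕ+) → GenFunctional (N : ℕ)) : Prop :=
  ∃ C : ℝ, ∀ᶠ N : ℕ+ in Filter.atTop, ∀ n : ℕ, 2 ≤ n → ∀ k : Fin (N : ℕ) → ℕ, ∑ i, k i = n →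
    (expect (mixedDeriv (T / (N : ℕ)) k (F N))) ^ 2 ≤
      C * ((n.factorial : ℝ) * chaosNormSq (T / (N : ℕ)) n (F N) / (T : ℝ) ^ n)

end

end DiscreteWiener


/-!
Expand everything in products of Hermite polynomials. The term `E[∂_l F | past of l] ΔW_l` collects
exactly the part of the expansion of `F` indexed by the multi-indices whose last nonzero entry is at
place `l` and equals `1`. So the error consists of the terms whose last nonzero entry is at least
`2`; call these error indices. Since `E[∂^k F]² = k! Δt^{-n} E[F H_k]²` for `|k| = n`, the
finite-dimensional property says `E[F H_k]² ≤ C ‖J_n F‖² N^{-n} n!/k!`. Every error index of degree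
`n` arises from some multi-index of degree `n - 1` by raising its last nonzero entry, which
multiplies the multinomial coefficient by at most `n`, so the multinomial coefficients of the error
indices sum to at most `n N^{n-1}`. Hence the error in the `n`-th chaos is at most
`min(1, C n / N) ‖J_n F‖² ≤ max(C, 1) (n / N)^s ‖J_n F‖²`, and the result follows by summing over
`n`.
-/

namespace DiscreteWiener

noncomputable section

/-! ### Polynomials and the Gaussian measure on the line -/

section OneDimensional

open Polynomial

theorem derivative_hermite_succ (n : ℕ) :
    derivative (hermite (n + 1)) = (n + 1 : ℤ[X]) * hermite n := by
  induction n with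
  | zero => simp
  | succ n ih =>
    rw [hermite_succ (n + 1), derivative_sub, derivative_mul, derivative_X, ih, derivative_mul,
      hermite_succ n]
    simp only [derivative_add, derivative_natCast, derivative_one]
    push_cast
    ring

theorem integrable_eval_gaussianReal (μ : ℝ) (v : ℝ≥0) (p : ℝ[X]) :
    Integrable (fun x => p.eval x) (gaussianReal μ v) := by
  simp_rw [eval_eq_sum_range]
  refine integrable_finsetSum _ fun i _ => Integrable.const_mul ?_ _
  refine (integrable_norm_iff (by fun_prop)).1 ?_
  simpa using (memLp_id_gaussianReal (μ := μ) (v := v) (i : ℝ≥0)).integrable_norm_pow'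

theorem hasDerivAt_gaussianPDFReal (μ : ℝ) (v : ℝ≥0) (x : ℝ) :
    HasDerivAt (gaussianPDFReal μ v) (-((x - μ) / v) * gaussianPDFReal μ v x) x := by
  have h_exponent : HasDerivAt (fun x : ℝ => -(x - μ) ^ 2 / (2 * v)) (-((x - μ) / v)) x := by
    convert! (((hasDerivAt_id x).sub_const μ).pow 2).neg.div_const (2 * (v : ℝ)) using 1
    simp only [id_eq]
    field_simp
    ring
  rw [gaussianPDFReal_def]
  convert! h_exponent.exp.const_mul (√(2 * Real.pi * v))⁻¹ using 1
  ring

theorem integral_sub_mul_eval_gaussianReal (μ : ℝ) (v : ℝ≥0) (p : ℝ[X]) :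
    ∫ x, (x - μ) * p.eval x ∂gaussianReal μ v =
      v * ∫ x, (derivative p).eval x ∂gaussianReal μ v := by
  obtain rfl | hv := eq_or_ne v 0
  · simp [gaussianReal_zero_var]
  have h_int (q : ℝ[X]) : Integrable fun x => gaussianPDFReal μ v x * q.eval x := by
    have h := integrable_eval_gaussianReal μ v q
    rw [gaussianReal_of_var_ne_zero μ hv, integrable_withDensity_iff_integrable_smul'
      (measurable_gaussianPDF μ v) (ae_of_all _ fun _ => gaussianPDF_lt_top)] at h
    simpa [toReal_gaussianPDF] using h
  have h_mul : Integrable fun x => gaussianPDFReal μ v x * ((x - μ) * p.eval x) := by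
    refine (h_int ((X - C μ) * p)).congr (ae_of_all _ fun x => ?_)
    simp only [eval_mul, eval_sub, eval_X, eval_C]
  have h_deriv (x : ℝ) : HasDerivAt (fun x => v * (gaussianPDFReal μ v x * p.eval x))
      (v * (gaussianPDFReal μ v x * (derivative p).eval x) -
        gaussianPDFReal μ v x * ((x - μ) * p.eval x)) x := by
    convert! ((hasDerivAt_gaussianPDFReal μ v x).mul (p.hasDerivAt x)).const_mul (v : ℝ) using 1
    have hv' : (v : ℝ) ≠ 0 := by exact_mod_cast hv
    field_simp
    ring
  have h_zero := integral_eq_zero_of_hasDerivAt_of_integrable h_deriv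
    (((h_int _).const_mul _).sub h_mul) ((h_int p).const_mul _)
  rw [integral_sub ((h_int _).const_mul _) h_mul, integral_const_mul, sub_eq_zero] at h_zero
  simpa only [integral_gaussianReal_eq_integral_smul hv, smul_eq_mul] using h_zero.symm

theorem integral_hermite_succ_mul (n : ℕ) (p : ℤ[X]) :
    ∫ x, aeval x (hermite (n + 1) * p) ∂gaussianReal 0 1 =
      ∫ x, aeval x (hermite n * derivative p) ∂gaussianReal 0 1 := by
  have h_int (q : ℤ[X]) : Integrable (fun x : ℝ => aeval x q) (gaussianReal 0 1) := by
    simpa only [eval_map_algebraMap] using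
      integrable_eval_gaussianReal 0 1 (q.map (algebraMap ℤ ℝ))
  have h_parts : ∫ x, aeval x (X * (hermite n * p)) ∂gaussianReal 0 1 =
      ∫ x, aeval x (derivative (hermite n * p)) ∂gaussianReal 0 1 := by
    simpa only [sub_zero, NNReal.coe_one, one_mul, derivative_map, eval_map_algebraMap,
      map_mul (aeval _) X, aeval_X] using
      integral_sub_mul_eval_gaussianReal 0 1 ((hermite n * p).map (algebraMap ℤ ℝ))
  rw [← sub_eq_zero, ← integral_sub (h_int _) (h_int _)] at h_parts ⊢
  rw [← h_parts]
  congr with x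
  rw [← map_sub, ← map_sub, hermite_succ, derivative_mul]
  congr 1
  ring

theorem integral_hermite_mul_hermite (m n : ℕ) :
    ∫ x, aeval x (hermite m * hermite n) ∂gaussianReal 0 1 =
      if m = n then (n.factorial : ℝ) else 0 := by
  induction m generalizing n with
  | zero =>
    cases n with
    | zero => simp
    | succ n =>
      rw [mul_comm, integral_hermite_succ_mul]
      simp
  | succ m ih =>
    rw [integral_hermite_succ_mul]
    cases n with
    | zero => simp
    | succ n =>
      rw [derivative_hermite_succ, mul_left_comm]
      simp_rw [map_mul (aeval _) ((n : ℤ[X]) + 1), map_add, map_natCast, map_one]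
      rw [integral_const_mul, ih]
      simp [Nat.factorial_succ]

/-- The normalized Hermite polynomial `H_m(x / √δ)`, as a function of `x`; these form the
orthonormal family of polynomials of the centered Gaussian measure of variance `δ`. -/
def normHermite (δ : ℝ≥0) (m : ℕ) (x : ℝ) : ℝ :=
  (√(m.factorial : ℝ))⁻¹ * aeval ((√(δ : ℝ))⁻¹ * x) (hermite m)

theorem normHermite_zero (δ : ℝ≥0) (x : ℝ) : normHermite δ 0 x = 1 := by
  simp [normHermite]

theorem gaussianReal_map_inv_sqrt_mul {δ : ℝ≥0} (hδ : δ ≠ 0) :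
    (gaussianReal 0 δ).map (fun x => (√(δ : ℝ))⁻¹ * x) = gaussianReal 0 1 := by
  rw [gaussianReal_map_const_mul, mul_zero]
  congr 1
  ext
  simp [Real.sq_sqrt, hδ]

theorem integral_normHermite_mul_normHermite {δ : ℝ≥0} (hδ : δ ≠ 0) (m n : ℕ) :
    ∫ x, normHermite δ m x * normHermite δ n x ∂gaussianReal 0 δ = if m = n then 1 else 0 := by
  have h_std := integral_hermite_mul_hermite m n
  rw [← gaussianReal_map_inv_sqrt_mul hδ, integral_map (by fun_prop)
    (Polynomial.continuous_aeval _).aestronglyMeasurable] at h_std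
  have h_factor (x : ℝ) : normHermite δ m x * normHermite δ n x =
      ((√(m.factorial : ℝ))⁻¹ * (√(n.factorial : ℝ))⁻¹) *
        aeval ((√(δ : ℝ))⁻¹ * x) (hermite m * hermite n) := by
    rw [normHermite, normHermite, map_mul]
    ring
  simp_rw [h_factor]
  rw [integral_const_mul, h_std]
  split_ifs with hmn
  · subst hmn
    have h_pos : (0 : ℝ) < m.factorial := by positivity
    rw [← mul_inv, Real.mul_self_sqrt h_pos.le, inv_mul_cancel₀ h_pos.ne']
  · rw [mul_zero]

end OneDimensional

/-! ### Creation and annihilation operators on the Hermite products -/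

open MvPolynomial (pderiv supported)

variable {N : ℕ}

/-- The factor of `hermiteProd` in the variable `i`, of degree `m`. -/
def hermiteFactor (δ : ℝ≥0) (i : Fin N) (m : ℕ) : MvPolynomial (Fin N) ℝ :=
  MvPolynomial.C (√(m.factorial : ℝ))⁻¹ *
    Polynomial.aeval (MvPolynomial.C (√(δ : ℝ))⁻¹ * MvPolynomial.X i) (Polynomial.hermite m)

theorem hermiteProd_zero (δ : ℝ≥0) : hermiteProd δ (0 : Fin N → ℕ) = 1 := by
  simp [hermiteProd]

theorem hermiteProd_eq_mul_prod_erase (δ : ℝ≥0) {k j : Fin N → ℕ} {l : Fin N}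
    (h : ∀ i ≠ l, j i = k i) :
    hermiteProd δ j =
      hermiteFactor δ l (j l) * ∏ i ∈ Finset.univ.erase l, hermiteFactor δ i (k i) := by
  rw [hermiteProd, ← Finset.mul_prod_erase _ _ (Finset.mem_univ l)]
  congr 1
  exact Finset.prod_congr rfl fun i hi => by rw [h i (Finset.ne_of_mem_erase hi), hermiteFactor]

theorem sqrt_succ_mul_inv_sqrt_factorial_succ (m : ℕ) :
    √((m : ℝ) + 1) * (√((m + 1).factorial : ℝ))⁻¹ = (√(m.factorial : ℝ))⁻¹ := by
  rw [Nat.factorial_succ, Nat.cast_mul, Real.sqrt_mul (by positivity)]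
  push_cast
  field_simp

theorem inv_sqrt_mul_inv_sqrt (δ : ℝ≥0) : (√(δ : ℝ))⁻¹ * (√(δ : ℝ))⁻¹ = (δ : ℝ)⁻¹ := by
  rw [← mul_inv, Real.mul_self_sqrt δ.coe_nonneg]

theorem pderiv_hermiteFactor (δ : ℝ≥0) (l i : Fin N) (m : ℕ) :
    pderiv l (hermiteFactor δ i m) =
      MvPolynomial.C ((√(m.factorial : ℝ))⁻¹ * (√(δ : ℝ))⁻¹) *
        Polynomial.aeval (MvPolynomial.C (√(δ : ℝ))⁻¹ * MvPolynomial.X i)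
          (Polynomial.derivative (Polynomial.hermite m)) *
        Pi.single (M := fun _ => MvPolynomial (Fin N) ℝ) l 1 i := by
  have h_chain := ((pderiv (R := ℝ) l).restrictScalars ℤ).map_aeval (Polynomial.hermite m)
    (MvPolynomial.C (√(δ : ℝ))⁻¹ * MvPolynomial.X i)
  simp only [Derivation.restrictScalars_apply] at h_chain
  rw [hermiteFactor, MvPolynomial.pderiv_C_mul, h_chain, MvPolynomial.pderiv_C_mul,
    MvPolynomial.pderiv_X]
  simp only [smul_eq_mul, map_mul]
  ring

theorem pderiv_hermiteFactor_of_ne (δ : ℝ≥0) {l i : Fin N} (h : i ≠ l) (m : ℕ) :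
    pderiv l (hermiteFactor δ i m) = 0 := by
  rw [pderiv_hermiteFactor, Pi.single_eq_of_ne h, mul_zero]

theorem pderiv_hermiteFactor_self (δ : ℝ≥0) (l : Fin N) (m : ℕ) :
    pderiv l (hermiteFactor δ l m) =
      MvPolynomial.C (√(m : ℝ) * (√(δ : ℝ))⁻¹) * hermiteFactor δ l (m - 1) := by
  cases m with
  | zero => simp [pderiv_hermiteFactor]
  | succ m =>
    have h_sqrt : √((m : ℝ) + 1) * √((m : ℝ) + 1) = m + 1 := Real.mul_self_sqrt (by positivity)
    have h_cast : (m : MvPolynomial (Fin N) ℝ) + 1 =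
        MvPolynomial.C √((m : ℝ) + 1) * MvPolynomial.C √((m : ℝ) + 1) := by
      rw [← map_mul, h_sqrt, map_add, map_natCast, map_one]
    rw [pderiv_hermiteFactor, derivative_hermite_succ, hermiteFactor, Nat.add_sub_cancel,
      ← sqrt_succ_mul_inv_sqrt_factorial_succ m, Nat.cast_succ]
    simp only [map_mul, map_add, map_natCast, map_one, h_cast, Pi.single_eq_same]
    ring

theorem pderiv_prod_erase_hermiteFactor (δ : ℝ≥0) (k : Fin N → ℕ) (l : Fin N) :
    pderiv l (∏ i ∈ Finset.univ.erase l, hermiteFactor δ i (k i)) = 0 := by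
  refine Finset.prod_induction _ (fun P => pderiv l P = 0) (fun P Q hP hQ => ?_)
    (Derivation.map_one_eq_zero _) fun i hi =>
      pderiv_hermiteFactor_of_ne δ (Finset.ne_of_mem_erase hi) _
  rw [Derivation.leibniz, hP, hQ, smul_zero, smul_zero, add_zero]

theorem pderiv_hermiteProd (δ : ℝ≥0) (k : Fin N → ℕ) (l : Fin N) :
    pderiv l (hermiteProd δ k) =
      (√(k l : ℝ) * (√(δ : ℝ))⁻¹) • hermiteProd δ (k - Pi.single l 1) := by
  rw [hermiteProd_eq_mul_prod_erase δ fun i (_ : i ≠ l) => rfl, Derivation.leibniz,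
    pderiv_prod_erase_hermiteFactor, pderiv_hermiteFactor_self,
    hermiteProd_eq_mul_prod_erase δ (k := k) (j := k - Pi.single l 1) (l := l) fun i hi => by
      simp [hi]]
  simp only [smul_eq_mul, MvPolynomial.smul_eq_C_mul, Pi.sub_apply, Pi.single_eq_same]
  ring

theorem derivAdjoint_apply (δ : ℝ≥0) (l : Fin N) (P : MvPolynomial (Fin N) ℝ) :
    derivAdjoint δ l P =
      MvPolynomial.C (δ : ℝ)⁻¹ * MvPolynomial.X l * P - pderiv l P := rfl

theorem derivAdjoint_hermiteFactor (δ : ℝ≥0) (l : Fin N) (m : ℕ) :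
    derivAdjoint δ l (hermiteFactor δ l m) =
      MvPolynomial.C (√((m : ℝ) + 1) * (√(δ : ℝ))⁻¹) * hermiteFactor δ l (m + 1) := by
  rw [derivAdjoint_apply, pderiv_hermiteFactor, hermiteFactor, hermiteFactor,
    ← sqrt_succ_mul_inv_sqrt_factorial_succ m, Polynomial.hermite_succ, ← inv_sqrt_mul_inv_sqrt]
  simp only [map_sub, map_mul, Polynomial.aeval_X, Pi.single_eq_same]
  ring

theorem derivAdjoint_hermiteProd (δ : ℝ≥0) (k : Fin N → ℕ) (l : Fin N) :
    derivAdjoint δ l (hermiteProd δ k) =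
      (√((k l : ℝ) + 1) * (√(δ : ℝ))⁻¹) • hermiteProd δ (k + Pi.single l 1) := by
  have h_factor := derivAdjoint_hermiteFactor δ l (k l)
  rw [hermiteProd_eq_mul_prod_erase δ fun i (_ : i ≠ l) => rfl,
    hermiteProd_eq_mul_prod_erase δ (k := k) (j := k + Pi.single l 1) (l := l) fun i hi => by
      simp [hi], MvPolynomial.smul_eq_C_mul, ← mul_assoc]
  simp only [Pi.add_apply, Pi.single_eq_same]
  rw [← h_factor]
  simp only [derivAdjoint_apply, Derivation.leibniz, pderiv_prod_erase_hermiteFactor, smul_eq_mul]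
  ring

theorem X_mul_hermiteProd {δ : ℝ≥0} (hδ : δ ≠ 0) (k : Fin N → ℕ) (l : Fin N) :
    MvPolynomial.X l * hermiteProd δ k =
      (√(δ : ℝ) * √((k l : ℝ) + 1)) • hermiteProd δ (k + Pi.single l 1) +
        (√(δ : ℝ) * √(k l : ℝ)) • hermiteProd δ (k - Pi.single l 1) := by
  have hδ' : (δ : ℝ) ≠ 0 := by exact_mod_cast hδ
  have h_coeff (a : ℝ) : (δ : ℝ) * (a * (√(δ : ℝ))⁻¹) = √(δ : ℝ) * a := by
    rw [mul_left_comm, ← div_eq_mul_inv, Real.div_sqrt, mul_comm]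
  have h_sum : MvPolynomial.X l * hermiteProd δ k =
      (δ : ℝ) • (derivAdjoint δ l (hermiteProd δ k) + pderiv l (hermiteProd δ k)) := by
    rw [derivAdjoint_apply, sub_add_cancel, mul_assoc, ← MvPolynomial.smul_eq_C_mul,
      smul_inv_smul₀ hδ']
  rw [h_sum, derivAdjoint_hermiteProd, pderiv_hermiteProd, smul_add, smul_smul, smul_smul,
    h_coeff, h_coeff]

/-- The span of the Hermite products in the variables belonging to `s`. -/
def hermiteSpan (δ : ℝ≥0) (s : Set (Fin N)) : Submodule ℝ (MvPolynomial (Fin N) ℝ) :=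
  Submodule.span ℝ (hermiteProd δ '' {k | Function.support k ⊆ s})

theorem X_mul_mem_hermiteSpan {δ : ℝ≥0} (hδ : δ ≠ 0) {s : Set (Fin N)} {l : Fin N} (hl : l ∈ s)
    {P : MvPolynomial (Fin N) ℝ} (hP : P ∈ hermiteSpan δ s) :
    MvPolynomial.X l * P ∈ hermiteSpan δ s := by
  have h_gen (k : Fin N → ℕ) (hk : Function.support k ⊆ s) :
      MvPolynomial.X l * hermiteProd δ k ∈ hermiteSpan δ s := by
    have h_mem {j : Fin N → ℕ} (hj : ∀ i ∉ s, j i = 0) : hermiteProd δ j ∈ hermiteSpan δ s :=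
      Submodule.subset_span ⟨j, Function.support_subset_iff'.2 hj, rfl⟩
    have hk' := Function.support_subset_iff'.1 hk
    have h_single {i : Fin N} (hi : i ∉ s) : (Pi.single l 1 : Fin N → ℕ) i = 0 :=
      Pi.single_eq_of_ne (ne_of_mem_of_not_mem hl hi).symm 1
    rw [X_mul_hermiteProd hδ]
    refine Submodule.add_mem _ (Submodule.smul_mem _ _ (h_mem fun i hi => ?_))
      (Submodule.smul_mem _ _ (h_mem fun i hi => ?_)) <;>
    simp [hk' i hi, h_single hi]
  exact (Submodule.span_le (p := (hermiteSpan δ s).comap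
    (LinearMap.mulLeft ℝ (MvPolynomial.X l)))).2 (Set.forall_mem_image.2 h_gen) hP

theorem mem_hermiteSpan_of_mem_supported {δ : ℝ≥0} (hδ : δ ≠ 0) {s : Set (Fin N)}
    {P : MvPolynomial (Fin N) ℝ} (hP : P ∈ supported ℝ s) : P ∈ hermiteSpan δ s := by
  have h_mul : ∀ Q ∈ hermiteSpan δ s, P * Q ∈ hermiteSpan δ s := by
    rw [MvPolynomial.supported_eq_adjoin_X] at hP
    induction hP using Algebra.adjoin_induction with
    | mem _ hx =>
      obtain ⟨l, hl, rfl⟩ := hx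
      exact fun Q hQ => X_mul_mem_hermiteSpan hδ hl hQ
    | algebraMap r =>
      intro Q hQ
      rw [← Algebra.smul_def]
      exact Submodule.smul_mem _ r hQ
    | add x y _ _ hx hy =>
      intro Q hQ
      rw [add_mul]
      exact Submodule.add_mem _ (hx Q hQ) (hy Q hQ)
    | mul x y _ _ hx hy =>
      intro Q hQ
      rw [mul_assoc]
      exact hx _ (hy Q hQ)
  have h_one : (1 : MvPolynomial (Fin N) ℝ) ∈ hermiteSpan δ s :=
    Submodule.subset_span ⟨0, by simp, hermiteProd_zero δ⟩
  simpa using h_mul 1 h_one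

/-! ### Mixed derivatives -/

/-- The multiple of `hermiteProd` on which every `derivAdjoint` acts as a shift of the index. -/
def rawHermiteProd (δ : ℝ≥0) (k : Fin N → ℕ) : MvPolynomial (Fin N) ℝ :=
  (∏ i, √((k i).factorial : ℝ) * (√(δ : ℝ))⁻¹ ^ k i) • hermiteProd δ k

theorem rawHermiteProd_zero (δ : ℝ≥0) : rawHermiteProd δ (0 : Fin N → ℕ) = 1 := by
  simp [rawHermiteProd, hermiteProd_zero]

theorem derivAdjoint_rawHermiteProd (δ : ℝ≥0) (k : Fin N → ℕ) (l : Fin N) :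
    derivAdjoint δ l (rawHermiteProd δ k) = rawHermiteProd δ (k + Pi.single l 1) := by
  have h_off : ∏ i ∈ Finset.univ.erase l, √(((k + Pi.single l 1 : Fin N → ℕ) i).factorial : ℝ) *
      (√(δ : ℝ))⁻¹ ^ (k + Pi.single l 1 : Fin N → ℕ) i =
      ∏ i ∈ Finset.univ.erase l, √((k i).factorial : ℝ) * (√(δ : ℝ))⁻¹ ^ k i :=
    Finset.prod_congr rfl fun i hi => by simp [Finset.ne_of_mem_erase hi]
  rw [rawHermiteProd, rawHermiteProd, map_smul, derivAdjoint_hermiteProd, smul_smul]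
  congr 1
  rw [← Finset.mul_prod_erase _ _ (Finset.mem_univ l),
    ← Finset.mul_prod_erase _ _ (Finset.mem_univ l), h_off, Pi.add_apply, Pi.single_eq_same,
    Nat.factorial_succ, Nat.cast_mul, Real.sqrt_mul (by positivity)]
  push_cast
  ring

theorem partialDeriv_pow_rawHermiteProd (δ : ℝ≥0) (X : GenFunctional N) (k : Fin N → ℕ)
    (l : Fin N) (m : ℕ) :
    (partialDeriv δ l ^ m) X (rawHermiteProd δ k) = X (rawHermiteProd δ (k + Pi.single l m)) := by
  induction m generalizing X with
  | zero => simp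
  | succ m ih =>
    rw [pow_succ, Module.End.mul_apply, ih, partialDeriv, LinearMap.dualMap_apply,
      derivAdjoint_rawHermiteProd, add_assoc, ← Pi.single_add]

theorem prod_partialDeriv_pow_rawHermiteProd (δ : ℝ≥0) (X : GenFunctional N) (k : Fin N → ℕ)
    (L : List (Fin N)) (j : Fin N → ℕ) :
    (L.map fun l => partialDeriv δ l ^ k l).prod X (rawHermiteProd δ j) =
      X (rawHermiteProd δ (j + (L.map fun l => Pi.single l (k l)).sum)) := by
  induction L generalizing j with
  | nil => simp
  | cons l L ih =>
    rw [List.map_cons, List.prod_cons, Module.End.mul_apply, partialDeriv_pow_rawHermiteProd, ih,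
      List.map_cons, List.sum_cons, add_assoc]

theorem expect_mixedDeriv (δ : ℝ≥0) (X : GenFunctional N) (k : Fin N → ℕ) :
    expect (mixedDeriv δ k X) = X (rawHermiteProd δ k) := by
  rw [expect, mixedDeriv, ← rawHermiteProd_zero δ, prod_partialDeriv_pow_rawHermiteProd, zero_add,
    ← List.ofFn_eq_map, List.sum_ofFn, Finset.univ_sum_single]

theorem sq_expect_mixedDeriv (δ : ℝ≥0) (X : GenFunctional N) (k : Fin N → ℕ) :
    expect (mixedDeriv δ k X) ^ 2 =
      (∏ l, ((k l).factorial : ℝ)) * (δ : ℝ)⁻¹ ^ (∑ l, k l) * X (hermiteProd δ k) ^ 2 := by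
  rw [expect_mixedDeriv, rawHermiteProd, map_smul, smul_eq_mul, mul_pow, ← Finset.prod_pow,
    ← Finset.prod_pow_eq_pow_sum, ← Finset.prod_mul_distrib]
  congr 1
  refine Finset.prod_congr rfl fun l _ => ?_
  rw [mul_pow, Real.sq_sqrt (by positivity), ← inv_sqrt_mul_inv_sqrt]
  ring

/-! ### Density of the polynomials -/

section Density

open Complex (I)

theorem integral_mul_cexp_eq_zero_of_moments {Ω : Type*} [MeasurableSpace Ω] {μ : Measure Ω}
    {g h : Ω → ℝ} (hg : AEStronglyMeasurable g μ) (hh : AEStronglyMeasurable h μ)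
    (h_exp : Integrable (fun x => |g x| * Real.exp |h x|) μ)
    (h_mom : ∀ n : ℕ, ∫ x, g x * h x ^ n ∂μ = 0) :
    ∫ x, (g x : ℂ) * Complex.exp (h x * I) ∂μ = 0 := by
  have h_term (n : ℕ) : ∫ x, (g x : ℂ) * ((h x * I) ^ n / n.factorial) ∂μ = 0 := by
    have h_real (x : Ω) : (g x : ℂ) * ((h x * I) ^ n / n.factorial) =
        (I ^ n / n.factorial) * ((g x * h x ^ n : ℝ) : ℂ) := by
      push_cast
      ring
    simp_rw [h_real]
    rw [integral_const_mul, integral_complex_ofReal, h_mom, Complex.ofReal_zero, mul_zero]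
  have h_sum := hasSum_integral_of_dominated_convergence (μ := μ)
    (F := fun (n : ℕ) x => (g x : ℂ) * ((h x * I) ^ n / n.factorial))
    (f := fun x => (g x : ℂ) * Complex.exp (h x * I))
    (fun n x => |g x| * (|h x| ^ n / n.factorial))
    (fun n => ?_) (fun n => ae_of_all _ fun x => ?_)
    (ae_of_all _ fun x => (Real.summable_pow_div_factorial _).mul_left _) ?_
    (ae_of_all _ fun x => ?_)
  · rw [← h_sum.tsum_eq, tsum_congr h_term, tsum_zero]
  · have h_cast {u : Ω → ℝ} (hu : AEStronglyMeasurable u μ) :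
        AEStronglyMeasurable (fun x => (u x : ℂ)) μ :=
      Complex.continuous_ofReal.comp_aestronglyMeasurable hu
    exact (h_cast hg).mul ((((h_cast hh).mul_const I).pow n).mul_const _)
  · simp
  · refine h_exp.congr (ae_of_all _ fun x => ?_)
    simp only [tsum_mul_left, Real.exp_eq_exp_ℝ, NormedSpace.exp_eq_tsum_div]
  · rw [Complex.exp_eq_exp_ℂ]
    exact (NormedSpace.expSeries_div_hasSum_exp (h x * I)).mul_left (g x : ℂ)

theorem ae_eq_zero_of_forall_integral_mul_cexp_eq_zero {E : Type*} [NormedAddCommGroup E]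
    [NormedSpace ℝ E] [CompleteSpace E] [SecondCountableTopology E] [MeasurableSpace E]
    [BorelSpace E] {μ : Measure E} {g : E → ℝ} (hg : Integrable g μ)
    (h_four : ∀ L : StrongDual ℝ E, ∫ x, (g x : ℂ) * Complex.exp (L x * I) ∂μ = 0) :
    g =ᵐ[μ] 0 := by
  have h_charFun {f : E → ℝ} (hf : Integrable f μ) (L : StrongDual ℝ E) :
      charFunDual (μ.withDensity fun x => ENNReal.ofReal (f x)) L =
        ∫ x, ((max (f x) 0 : ℝ) : ℂ) * Complex.exp (L x * I) ∂μ := by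
    rw [charFunDual_apply, integral_withDensity_eq_integral_toReal_smul₀
      hf.1.aemeasurable.ennreal_ofReal (ae_of_all _ fun _ => ENNReal.ofReal_lt_top)]
    simp [ENNReal.toReal_ofReal', Complex.real_smul]
  have h_int {f : E → ℝ} (hf : Integrable f μ) (L : StrongDual ℝ E) :
      Integrable (fun x => ((max (f x) 0 : ℝ) : ℂ) * Complex.exp (L x * I)) μ :=
    (hf.pos_part.ofReal (𝕜 := ℂ)).mul_bdd (c := 1)
      (Continuous.aestronglyMeasurable (by fun_prop))
      (ae_of_all _ fun x => (Complex.norm_exp_ofReal_mul_I _).le)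
  have h_parts : μ.withDensity (fun x => ENNReal.ofReal (g x)) =
      μ.withDensity fun x => ENNReal.ofReal (-g x) := by
    have := isFiniteMeasure_withDensity_ofReal hg.2
    have := isFiniteMeasure_withDensity_ofReal hg.neg.2
    refine Measure.ext_of_charFunDual (funext fun L => ?_)
    refine (h_charFun hg L).trans (Eq.trans ?_ (h_charFun hg.neg L).symm)
    rw [← sub_eq_zero, ← integral_sub (h_int hg L) (h_int hg.neg L), ← h_four L]
    refine integral_congr_ae (ae_of_all _ fun x => ?_)
    simp only [Pi.neg_apply, ← sub_mul, ← Complex.ofReal_sub, max_zero_sub_max_neg_zero_eq_self]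
  have h_ae := (withDensity_eq_iff hg.1.aemeasurable.ennreal_ofReal
    hg.1.aemeasurable.neg.ennreal_ofReal hg.lintegral_lt_top.ne).1 h_parts
  filter_upwards [h_ae] with x hx
  have h_max : max (g x) 0 = max (-g x) 0 := by
    simpa only [ENNReal.toReal_ofReal', Pi.neg_apply] using congrArg ENNReal.toReal hx
  rw [Pi.zero_apply, ← max_zero_sub_max_neg_zero_eq_self (g x), h_max, sub_self]

end Density

instance isProbabilityMeasure_wienerMeasure (N : ℕ) (δ : ℝ≥0) :
    IsProbabilityMeasure (wienerMeasure N δ) :=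
  inferInstanceAs (IsProbabilityMeasure (Measure.pi _))

theorem integrable_eval (δ : ℝ≥0) (P : MvPolynomial (Fin N) ℝ) :
    Integrable (fun x => MvPolynomial.eval x P) (wienerMeasure N δ) := by
  induction P using MvPolynomial.induction_on' with
  | monomial u a =>
    simp only [MvPolynomial.eval_monomial, Finsupp.prod_pow]
    refine (Integrable.fintype_prod (f := fun i y => y ^ u i) fun i => ?_).const_mul a
    simpa using integrable_eval_gaussianReal 0 δ (Polynomial.X ^ u i)
  | add P Q hP hQ => exact (hP.add hQ).congr (ae_of_all _ fun x => (map_add _ P Q).symm)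

theorem memLp_eval (δ : ℝ≥0) (P : MvPolynomial (Fin N) ℝ) :
    MemLp (fun x => MvPolynomial.eval x P) 2 (wienerMeasure N δ) := by
  rw [memLp_two_iff_integrable_sq (MvPolynomial.continuous_eval P).aestronglyMeasurable]
  exact (integrable_eval δ (P ^ 2)).congr (ae_of_all _ fun x => map_pow _ P 2)

theorem dual_apply_eq_sum_mul {ι : Type*} [Fintype ι] [DecidableEq ι] (L : Module.Dual ℝ (ι → ℝ))
    (x : ι → ℝ) : L x = ∑ i, L (Pi.single i 1) * x i := by
  conv_lhs => rw [pi_eq_sum_univ' x]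
  simp [mul_comm]

theorem memLp_exp_abs_dual (δ : ℝ≥0) (L : StrongDual ℝ (Fin N → ℝ)) :
    MemLp (fun x => Real.exp |L x|) 2 (wienerMeasure N δ) := by
  have h_abs (x : Fin N → ℝ) : |L x| ≤ ∑ i, |L (Pi.single i 1)| * |x i| := by
    rw [show L x = _ from dual_apply_eq_sum_mul (L : Module.Dual ℝ (Fin N → ℝ)) x]
    exact (Finset.abs_sum_le_sum_abs _ _).trans_eq (Finset.sum_congr rfl fun i _ => abs_mul _ _)
  have h_prod : Integrable (fun x => ∏ i, Real.exp (2 * |L (Pi.single i 1)| * |x i|))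
      (wienerMeasure N δ) :=
    Integrable.fintype_prod (f := fun i y => Real.exp (2 * |L (Pi.single i 1)| * |y|)) fun i =>
      integrable_exp_mul_abs (integrable_exp_mul_gaussianReal _)
        (integrable_exp_mul_gaussianReal _)
  rw [memLp_two_iff_integrable_sq (Continuous.aestronglyMeasurable (by fun_prop))]
  refine h_prod.mono' (Continuous.aestronglyMeasurable (by fun_prop)) (ae_of_all _ fun x => ?_)
  rw [Real.norm_of_nonneg (by positivity), ← Real.exp_sum, ← Real.exp_nat_mul]
  simp_rw [mul_assoc, ← Finset.mul_sum]
  gcongr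
  exacts [by norm_num, h_abs x]

theorem ae_eq_zero_of_forall_integral_mul_eval_eq_zero {δ : ℝ≥0} {g : (Fin N → ℝ) → ℝ}
    (hg : MemLp g 2 (wienerMeasure N δ))
    (h_orth : ∀ P : MvPolynomial (Fin N) ℝ,
      ∫ x, g x * MvPolynomial.eval x P ∂wienerMeasure N δ = 0) :
    g =ᵐ[wienerMeasure N δ] 0 := by
  refine ae_eq_zero_of_forall_integral_mul_cexp_eq_zero (hg.integrable one_le_two) fun L =>
    integral_mul_cexp_eq_zero_of_moments hg.1 L.continuous.aestronglyMeasurable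
      (hg.abs.integrable_mul (memLp_exp_abs_dual δ L)) fun n => ?_
  have h_pow := h_orth ((∑ i, MvPolynomial.C (L (Pi.single i 1)) * MvPolynomial.X i) ^ n)
  simp only [map_pow, map_sum, map_mul, MvPolynomial.eval_C, MvPolynomial.eval_X] at h_pow
  rw [← h_pow]
  congr with x
  rw [show L x = _ from dual_apply_eq_sum_mul (L : Module.Dual ℝ (Fin N → ℝ)) x]
  rfl

/-! ### The Hermite basis of `L²` -/

theorem eval_hermiteProd (δ : ℝ≥0) (k : Fin N → ℕ) (x : Fin N → ℝ) :
    MvPolynomial.eval x (hermiteProd δ k) = ∏ i, normHermite δ (k i) (x i) := by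
  rw [hermiteProd, map_prod]
  refine Finset.prod_congr rfl fun i _ => ?_
  rw [normHermite, map_mul, MvPolynomial.eval_C, Polynomial.aeval_def, Polynomial.hom_eval₂,
    map_mul, MvPolynomial.eval_C, MvPolynomial.eval_X, Polynomial.aeval_def,
    RingHom.ext_int (algebraMap ℤ ℝ)]

theorem integral_hermiteProd_mul_hermiteProd {δ : ℝ≥0} (hδ : δ ≠ 0) (j k : Fin N → ℕ) :
    ∫ x, MvPolynomial.eval x (hermiteProd δ j) * MvPolynomial.eval x (hermiteProd δ k)
      ∂wienerMeasure N δ = if j = k then 1 else 0 := by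
  simp_rw [eval_hermiteProd, ← Finset.prod_mul_distrib]
  rw [wienerMeasure, integral_fintype_prod_eq_prod
    (f := fun i x => normHermite δ (j i) x * normHermite δ (k i) x)]
  simp_rw [integral_normHermite_mul_normHermite hδ]
  split_ifs with hjk
  · simp [hjk]
  · obtain ⟨i, hi⟩ := Function.ne_iff.1 hjk
    exact Finset.prod_eq_zero (Finset.mem_univ i) (if_neg hi)

theorem inner_toLp_toLp {Ω : Type*} [MeasurableSpace Ω] {μ : Measure Ω} {f g : Ω → ℝ}
    (hf : MemLp f 2 μ) (hg : MemLp g 2 μ) : inner ℝ hf.toLp hg.toLp = ∫ x, f x * g x ∂μ := by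
  rw [L2.inner_def]
  refine integral_congr_ae ?_
  filter_upwards [hf.coeFn_toLp, hg.coeFn_toLp] with x hx hy
  rw [hx, hy, Real.inner_apply]

/-- The embedding of the polynomials into `L²(μ^N)`. -/
def evalLp (N : ℕ) (δ : ℝ≥0) : MvPolynomial (Fin N) ℝ →ₗ[ℝ] Lp ℝ 2 (wienerMeasure N δ) where
  toFun P := (memLp_eval δ P).toLp
  map_add' P Q := by
    rw [← MemLp.toLp_add, MemLp.toLp_eq_toLp_iff]
    exact ae_of_all _ fun x => map_add _ P Q
  map_smul' c P := by
    rw [RingHom.id_apply, ← MemLp.toLp_const_smul, MemLp.toLp_eq_toLp_iff]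
    exact ae_of_all _ fun x => MvPolynomial.smul_eval x P c

theorem inner_toLp_evalLp {δ : ℝ≥0} {f : (Fin N → ℝ) → ℝ} (hf : MemLp f 2 (wienerMeasure N δ))
    (P : MvPolynomial (Fin N) ℝ) :
    inner ℝ hf.toLp (evalLp N δ P) = ∫ x, f x * MvPolynomial.eval x P ∂wienerMeasure N δ :=
  inner_toLp_toLp hf (memLp_eval δ P)

theorem orthonormal_evalLp_hermiteProd {δ : ℝ≥0} (hδ : δ ≠ 0) :
    Orthonormal ℝ fun k : Fin N → ℕ => evalLp N δ (hermiteProd δ k) :=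
  orthonormal_iff_ite.2 fun j k =>
    (inner_toLp_evalLp (memLp_eval δ _) _).trans (integral_hermiteProd_mul_hermiteProd hδ j k)

theorem eq_integral_mul_eval_of_mem_supported {δ : ℝ≥0} (hδ : δ ≠ 0) {X : GenFunctional N}
    {g : (Fin N → ℝ) → ℝ} (hg : MemLp g 2 (wienerMeasure N δ)) {s : Set (Fin N)}
    (h_herm : ∀ k : Fin N → ℕ, Function.support k ⊆ s → X (hermiteProd δ k) =
      ∫ x, g x * MvPolynomial.eval x (hermiteProd δ k) ∂wienerMeasure N δ)
    {P : MvPolynomial (Fin N) ℝ} (hP : P ∈ supported ℝ s) :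
    X P = ∫ x, g x * MvPolynomial.eval x P ∂wienerMeasure N δ := by
  rw [← inner_toLp_evalLp hg]
  refine LinearMap.eqOn_span' (f := X) (g := innerₛₗ ℝ hg.toLp ∘ₗ evalLp N δ) ?_
    (mem_hermiteSpan_of_mem_supported hδ hP)
  rintro _ ⟨k, hk, rfl⟩
  exact (h_herm k hk).trans (inner_toLp_evalLp hg _).symm

theorem orthogonal_span_evalLp_hermiteProd {δ : ℝ≥0} (hδ : δ ≠ 0) :
    (Submodule.span ℝ (Set.range fun k : Fin N → ℕ => evalLp N δ (hermiteProd δ k)))ᗮ = ⊥ := by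
  refine (Submodule.eq_bot_iff _).2 fun u hu => ?_
  have hu_memLp : MemLp u 2 (wienerMeasure N δ) := Lp.memLp u
  have h_herm (k : Fin N → ℕ) :
      ∫ x, u x * MvPolynomial.eval x (hermiteProd δ k) ∂wienerMeasure N δ = 0 := by
    rw [← inner_toLp_evalLp hu_memLp, Lp.toLp_coeFn]
    exact Submodule.inner_left_of_mem_orthogonal (Submodule.subset_span (Set.mem_range_self k)) hu
  refine (Lp.eq_zero_iff_ae_eq_zero).2
    (ae_eq_zero_of_forall_integral_mul_eval_eq_zero hu_memLp fun P => ?_)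
  exact (eq_integral_mul_eval_of_mem_supported (X := 0) (s := Set.univ) hδ hu_memLp
    (fun k _ => (h_herm k).symm) (by simp)).symm

/-- The Hilbert basis of `L²(μ^N)` formed by the Hermite products. -/
def hermiteBasis (N : ℕ) {δ : ℝ≥0} (hδ : δ ≠ 0) :
    HilbertBasis (Fin N → ℕ) ℝ (Lp ℝ 2 (wienerMeasure N δ)) :=
  HilbertBasis.mkOfOrthogonalEqBot (orthonormal_evalLp_hermiteProd hδ)
    (orthogonal_span_evalLp_hermiteProd hδ)

theorem hermiteBasis_apply {δ : ℝ≥0} (hδ : δ ≠ 0) (k : Fin N → ℕ) :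
    hermiteBasis N hδ k = evalLp N δ (hermiteProd δ k) :=
  congrFun (HilbertBasis.coe_mkOfOrthogonalEqBot _ _) k

theorem exists_memLp_of_summable_sq {δ : ℝ≥0} (hδ : δ ≠ 0) {c : (Fin N → ℕ) → ℝ}
    (hc : Summable fun k => c k ^ 2) :
    ∃ f : (Fin N → ℝ) → ℝ, MemLp f 2 (wienerMeasure N δ) ∧
      ∀ k, ∫ x, f x * MvPolynomial.eval x (hermiteProd δ k) ∂wienerMeasure N δ = c k := by
  have hc_mem : Memℓp c 2 := (memℓp_gen_iff (by norm_num)).2 (by simpa using hc)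
  let w : lp (fun _ : Fin N → ℕ => ℝ) 2 := ⟨c, hc_mem⟩
  let u := (hermiteBasis N hδ).repr.symm w
  refine ⟨u, Lp.memLp u, fun k => ?_⟩
  rw [← inner_toLp_evalLp (Lp.memLp u), Lp.toLp_coeFn, real_inner_comm, ← hermiteBasis_apply hδ,
    ← HilbertBasis.repr_apply_apply, LinearIsometryEquiv.apply_symm_apply]

theorem hasSum_sq_integral_mul_hermiteProd {δ : ℝ≥0} (hδ : δ ≠ 0) {f : (Fin N → ℝ) → ℝ}
    (hf : MemLp f 2 (wienerMeasure N δ)) :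
    HasSum (fun k => (∫ x, f x * MvPolynomial.eval x (hermiteProd δ k) ∂wienerMeasure N δ) ^ 2)
      (∫ x, f x ^ 2 ∂wienerMeasure N δ) := by
  have h_parseval := (hermiteBasis N hδ).hasSum_inner_mul_inner hf.toLp hf.toLp
  simp_rw [hermiteBasis_apply, real_inner_comm hf.toLp, inner_toLp_evalLp, inner_toLp_toLp,
    ← sq] at h_parseval
  exact h_parseval

theorem chaosNormSq_eq_sum_sq {δ : ℝ≥0} (hδ : δ ≠ 0) (n : ℕ) (X : GenFunctional N) :
    chaosNormSq δ n X =
      ∑ k ∈ Finset.piAntidiag (Finset.univ : Finset (Fin N)) n, X (hermiteProd δ k) ^ 2 := by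
  have h_inner : chaosNormSq δ n X =
      inner ℝ (evalLp N δ (chaosProj δ n X)) (evalLp N δ (chaosProj δ n X)) := by
    simp_rw [chaosNormSq, sq]
    exact (inner_toLp_evalLp (memLp_eval δ _) _).symm
  rw [h_inner, chaosProj]
  simp_rw [map_sum, map_smul]
  rw [(orthonormal_evalLp_hermiteProd hδ).inner_sum]
  simp [sq]

/-! ### Chaos coefficients of the martingale representation error -/

/-- The sigma-algebra generated by the coordinates in `s`. -/
abbrev coordSigma (s : Set (Fin N)) : MeasurableSpace (Fin N → ℝ) :=
  ⨆ i ∈ s, MeasurableSpace.comap (fun x => x i) inferInstance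

theorem coordSigma_mono {s t : Set (Fin N)} (h : s ⊆ t) : coordSigma s ≤ coordSigma t :=
  biSup_mono h

theorem coordSigma_le_pi (s : Set (Fin N)) : coordSigma s ≤ MeasurableSpace.pi :=
  iSup₂_le fun i _ => (measurable_pi_apply i).comap_le

theorem pastSigma_eq_coordSigma (l : Fin N) : pastSigma l = coordSigma (Set.Iio l) :=
  iSup_subtype

theorem pastSigma_le_coordSigma_compl {l i : Fin N} (h : l ≤ i) :
    pastSigma l ≤ coordSigma {i}ᶜ :=
  (pastSigma_eq_coordSigma l).trans_le (coordSigma_mono fun _ hj => (hj.trans_le h).ne)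

theorem IsCondExpPast.measurable_coordSigma_compl {δ : ℝ≥0} {X : GenFunctional N} {l i : Fin N}
    {Y : (Fin N → ℝ) → ℝ} (hY : IsCondExpPast δ X l Y) (h : l ≤ i) :
    Measurable[coordSigma {i}ᶜ] Y :=
  hY.1.mono (pastSigma_le_coordSigma_compl h) le_rfl

theorem measurable_coordSigma_apply {s : Set (Fin N)} {i : Fin N} (hi : i ∈ s) :
    Measurable[coordSigma s] fun x : Fin N → ℝ => x i :=
  Measurable.of_comap_le (le_iSup₂_of_le i hi le_rfl)

theorem measurable_eval_of_mem_supported {s : Set (Fin N)} {P : MvPolynomial (Fin N) ℝ}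
    (hP : P ∈ supported ℝ s) : Measurable[coordSigma s] fun x => MvPolynomial.eval x P := by
  rw [MvPolynomial.supported_eq_adjoin_X] at hP
  induction hP using Algebra.adjoin_induction with
  | mem _ hx =>
    obtain ⟨i, hi, rfl⟩ := hx
    simpa only [MvPolynomial.eval_X] using measurable_coordSigma_apply hi
  | algebraMap r => simp only [MvPolynomial.algebraMap_eq, MvPolynomial.eval_C, measurable_const]
  | add P Q _ _ hP hQ =>
    simp only [map_add]
    exact hP.add hQ
  | mul P Q _ _ hP hQ =>
    simp only [map_mul]
    exact hP.mul hQ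

theorem hermiteProd_mem_supported (δ : ℝ≥0) {s : Set (Fin N)} {k : Fin N → ℕ}
    (hk : Function.support k ⊆ s) : hermiteProd δ k ∈ supported ℝ s := by
  refine prod_mem fun i _ => ?_
  by_cases hi : k i = 0
  · simp [hi]
  · have h_X : (MvPolynomial.X i : MvPolynomial (Fin N) ℝ) ∈ supported ℝ s :=
      MvPolynomial.X_mem_supported.2 (hk hi)
    rw [Polynomial.aeval_eq_sum_range]
    exact mul_mem (Subalgebra.algebraMap_mem _ _) (sum_mem fun j _ =>
      zsmul_mem (pow_mem (mul_mem (Subalgebra.algebraMap_mem _ _) h_X) _) _)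

theorem indepFun_apply (δ : ℝ≥0) {i : Fin N} {Y : (Fin N → ℝ) → ℝ}
    (hY : Measurable[coordSigma {i}ᶜ] Y) : IndepFun Y (fun x => x i) (wienerMeasure N δ) := by
  have h_indep : Indep (coordSigma {i}ᶜ) (coordSigma {i}) (wienerMeasure N δ) :=
    indep_iSup_of_disjoint (fun j => (measurable_pi_apply j).comap_le)
      (iIndepFun_pi (X := fun _ => id) fun _ => aemeasurable_id) disjoint_compl_left
  exact indep_of_indep_of_le_left (indep_of_indep_of_le_right h_indep
    (measurable_coordSigma_apply (Set.mem_singleton i)).comap_le) hY.comap_le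

theorem memLp_mul_apply {δ : ℝ≥0} {i : Fin N} {Y : (Fin N → ℝ) → ℝ}
    (hY : Measurable[coordSigma {i}ᶜ] Y) (hY_memLp : MemLp Y 2 (wienerMeasure N δ)) :
    MemLp (fun x => Y x * x i) 2 (wienerMeasure N δ) := by
  have h_coord : MemLp (fun x : Fin N → ℝ => x i) 2 (wienerMeasure N δ) := by
    simpa only [MvPolynomial.eval_X] using memLp_eval δ (MvPolynomial.X i)
  refine (memLp_two_iff_integrable_sq (hY_memLp.1.mul h_coord.1)).2 ?_
  simp only [Pi.mul_apply, mul_pow]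
  exact ((indepFun_apply δ hY).comp (measurable_id.pow_const 2)
    (measurable_id.pow_const 2)).integrable_mul hY_memLp.integrable_sq h_coord.integrable_sq

theorem eval_hermiteProd_eq_mul_update (δ : ℝ≥0) (k : Fin N → ℕ) (i : Fin N) (x : Fin N → ℝ) :
    MvPolynomial.eval x (hermiteProd δ k) =
      normHermite δ (k i) (x i) *
        MvPolynomial.eval x (hermiteProd δ (Function.update k i 0)) := by
  rw [eval_hermiteProd, eval_hermiteProd, ← Finset.mul_prod_erase _ _ (Finset.mem_univ i),
    ← Finset.mul_prod_erase _ (fun j => normHermite δ (Function.update k i 0 j) (x j))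
      (Finset.mem_univ i), Function.update_self, normHermite_zero, one_mul]
  congr 1
  exact Finset.prod_congr rfl fun j hj => by rw [Function.update_of_ne (Finset.ne_of_mem_erase hj)]

theorem integral_normHermite_apply {δ : ℝ≥0} (hδ : δ ≠ 0) (i : Fin N) {m : ℕ} (hm : m ≠ 0) :
    ∫ x, normHermite δ m (x i) ∂wienerMeasure N δ = 0 := by
  have h_orth := integral_hermiteProd_mul_hermiteProd hδ (Pi.single i m) (0 : Fin N → ℕ)
  have h_update : Function.update (Pi.single i m) i 0 = (0 : Fin N → ℕ) := by simp [Pi.single]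
  rw [if_neg (by simpa using hm)] at h_orth
  simpa [hermiteProd_zero, eval_hermiteProd_eq_mul_update δ (Pi.single i m) i, h_update]
    using h_orth

theorem integral_mul_hermiteProd_eq_zero {δ : ℝ≥0} (hδ : δ ≠ 0) {i : Fin N}
    {Y : (Fin N → ℝ) → ℝ} (hY : Measurable[coordSigma {i}ᶜ] Y) {k : Fin N → ℕ} (hk : k i ≠ 0) :
    ∫ x, Y x * MvPolynomial.eval x (hermiteProd δ k) ∂wienerMeasure N δ = 0 := by
  have h_rest : Measurable[coordSigma {i}ᶜ] fun x =>
      Y x * MvPolynomial.eval x (hermiteProd δ (Function.update k i 0)) :=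
    hY.mul (measurable_eval_of_mem_supported (hermiteProd_mem_supported δ
      (Function.support_subset_iff'.2 fun j hj => by
        obtain rfl : j = i := by simpa using hj
        exact Function.update_self ..)))
  have h_herm : Measurable fun y => normHermite δ (k i) y := by
    unfold normHermite
    fun_prop
  have h_mul := ((indepFun_apply δ h_rest).comp measurable_id
    h_herm).integral_fun_mul_eq_mul_integral
    (h_rest.mono (coordSigma_le_pi _) le_rfl).aestronglyMeasurable
    (h_herm.comp (measurable_pi_apply i)).aestronglyMeasurable
  simp only [Function.comp_apply, id, integral_normHermite_apply hδ i hk, mul_zero] at h_mul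
  simp_rw [← h_mul, eval_hermiteProd_eq_mul_update δ k i]
  congr with x
  ring

theorem partialDeriv_hermiteProd (δ : ℝ≥0) (X : GenFunctional N) (k : Fin N → ℕ) (l : Fin N) :
    partialDeriv δ l X (hermiteProd δ k) =
      √((k l : ℝ) + 1) * (√(δ : ℝ))⁻¹ * X (hermiteProd δ (k + Pi.single l 1)) := by
  rw [partialDeriv, LinearMap.dualMap_apply, derivAdjoint_hermiteProd, map_smul, smul_eq_mul]

theorem sub_single_add_single {ι : Type*} [DecidableEq ι] {k : ι → ℕ} {l : ι} (hl : k l ≠ 0) :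
    k - Pi.single l 1 + Pi.single l 1 = k :=
  tsub_add_cancel_of_le fun i => by
    obtain rfl | hi := eq_or_ne i l
    · simpa using Nat.one_le_iff_ne_zero.2 hl
    · simp [hi]

theorem IsCondExpPast.integral_mul_hermiteProd_sub_single {δ : ℝ≥0} (hδ : δ ≠ 0) {l : Fin N}
    {X : GenFunctional N} {Y : (Fin N → ℝ) → ℝ} (hY : IsCondExpPast δ (partialDeriv δ l X) l Y)
    {k : Fin N → ℕ} (hk : k l ≠ 0) :
    √(δ : ℝ) * √(k l : ℝ) *
        ∫ x, Y x * MvPolynomial.eval x (hermiteProd δ (k - Pi.single l 1)) ∂wienerMeasure N δ =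
      if k l = 1 ∧ ∀ i, l < i → k i = 0 then X (hermiteProd δ k) else 0 := by
  split_ifs with h_last
  · have h_past : Function.support (k - Pi.single l 1) ⊆ Set.Iio l := by
      refine Function.support_subset_iff'.2 fun i hi => ?_
      obtain rfl | hli := (not_lt.1 (Set.mem_Iio.not.1 hi)).eq_or_lt
      · simp [h_last.1]
      · simp [h_last.2 i hli]
    have hδ' : √(δ : ℝ) ≠ 0 := Real.sqrt_ne_zero'.2 (by exact_mod_cast pos_of_ne_zero hδ)
    rw [← hY.2.2 _ (hermiteProd_mem_supported δ h_past), partialDeriv_hermiteProd,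
      sub_single_add_single hk]
    simp [h_last.1, hδ']
  · obtain ⟨i, hli, hi⟩ : ∃ i, l ≤ i ∧ (k - Pi.single l 1 : Fin N → ℕ) i ≠ 0 := by
      by_cases h_one : k l = 1
      · push Not at h_last
        obtain ⟨i, hli, hi⟩ := h_last h_one
        exact ⟨i, hli.le, by simpa [hli.ne'] using hi⟩
      · exact ⟨l, le_rfl, by simp; omega⟩
    rw [integral_mul_hermiteProd_eq_zero hδ
      (hY.measurable_coordSigma_compl hli) hi, mul_zero]

theorem IsCondExpPast.integral_mul_apply_mul_hermiteProd {δ : ℝ≥0} (hδ : δ ≠ 0) {l : Fin N}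
    {X : GenFunctional N} {Y : (Fin N → ℝ) → ℝ} (hY : IsCondExpPast δ (partialDeriv δ l X) l Y)
    (k : Fin N → ℕ) :
    ∫ x, Y x * x l * MvPolynomial.eval x (hermiteProd δ k) ∂wienerMeasure N δ =
      if k l = 1 ∧ ∀ i, l < i → k i = 0 then X (hermiteProd δ k) else 0 := by
  have h_int (P : MvPolynomial (Fin N) ℝ) :
      Integrable (fun x => Y x * MvPolynomial.eval x P) (wienerMeasure N δ) :=
    hY.2.1.integrable_mul (memLp_eval δ P)
  have h_expand (x : Fin N → ℝ) : Y x * x l * MvPolynomial.eval x (hermiteProd δ k) =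
      √(δ : ℝ) * √((k l : ℝ) + 1) *
          (Y x * MvPolynomial.eval x (hermiteProd δ (k + Pi.single l 1))) +
        √(δ : ℝ) * √(k l : ℝ) *
          (Y x * MvPolynomial.eval x (hermiteProd δ (k - Pi.single l 1))) := by
    have h_eval := congrArg (MvPolynomial.eval x) (X_mul_hermiteProd hδ k l)
    simp only [map_add, map_mul, MvPolynomial.smul_eval, MvPolynomial.eval_X] at h_eval
    linear_combination Y x * h_eval
  have h_raise : ∫ x, Y x * MvPolynomial.eval x (hermiteProd δ (k + Pi.single l 1))
      ∂wienerMeasure N δ = 0 :=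
    integral_mul_hermiteProd_eq_zero hδ
      (hY.measurable_coordSigma_compl le_rfl) (by simp)
  simp_rw [h_expand]
  rw [integral_add ((h_int _).const_mul _) ((h_int _).const_mul _), integral_const_mul,
    integral_const_mul, h_raise, mul_zero, zero_add]
  by_cases hk : k l = 0
  · simp [hk]
  · exact hY.integral_mul_hermiteProd_sub_single hδ hk

section LastEntry

variable {ι : Type*} [LinearOrder ι]

theorem existsUnique_last_ne_zero [Finite ι] {M : Type*} [Zero M] {k : ι → M} (hk : k ≠ 0) :
    ∃! l, k l ≠ 0 ∧ ∀ i, l < i → k i = 0 := by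
  obtain ⟨i, hi⟩ := Function.ne_iff.1 hk
  obtain ⟨l, hl⟩ := (Set.toFinite {i | k i ≠ 0}).exists_maximal ⟨i, hi⟩
  have hl_last (j) (hlj : l < j) : k j = 0 := by_contra fun hj => hl.not_prop_of_gt hlj hj
  refine ⟨l, ⟨hl.prop, hl_last⟩, ?_⟩
  rintro m ⟨hm, hm_last⟩
  exact le_antisymm (not_lt.1 fun hlm => hm (hl_last m hlm))
    (not_lt.1 fun hml => hl.prop (hm_last l hml))

/-- The multi-indices whose last nonzero entry is at least two. These are the ones that contribute
to the first order error: the integrals against the increments only produce multi-indices whose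
last nonzero entry is `1`. -/
def IsErrIndex (k : ι → ℕ) : Prop := ∃ l, 2 ≤ k l ∧ ∀ i, l < i → k i = 0

instance decidableIsErrIndex [Fintype ι] (k : ι → ℕ) : Decidable (IsErrIndex k) :=
  inferInstanceAs (Decidable (∃ l, 2 ≤ k l ∧ ∀ i, l < i → k i = 0))

theorem sub_ite_sub_sum_ite_last_eq_one [Fintype ι] {A : Type*} [AddCommGroup A] (k : ι → ℕ)
    (a : A) :
    a - (if k = 0 then a else 0) - ∑ l, (if k l = 1 ∧ ∀ i, l < i → k i = 0 then a else 0) =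
      if IsErrIndex k then a else 0 := by
  obtain rfl | hk := eq_or_ne k 0
  · simp [IsErrIndex]
  obtain ⟨l, ⟨hl, hl_last⟩, hl_unique⟩ := existsUnique_last_ne_zero hk
  have h_err : IsErrIndex k ↔ k l ≠ 1 := by
    refine ⟨fun ⟨m, hm, hm_last⟩ => ?_, fun h => ⟨l, by omega, hl_last⟩⟩
    rw [← hl_unique m ⟨by omega, hm_last⟩]
    omega
  have h_sum : (∑ m, if k m = 1 ∧ ∀ i, m < i → k i = 0 then a else 0) =
      if k l = 1 then a else 0 := by
    rw [Finset.sum_eq_single_of_mem l (Finset.mem_univ l) fun m _ hml =>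
      if_neg fun ⟨hm, hm_last⟩ => hml (hl_unique m ⟨hm.trans_ne one_ne_zero, hm_last⟩)]
    exact if_congr (and_iff_left hl_last) rfl rfl
  rw [h_sum, if_neg hk, sub_zero, if_congr h_err rfl rfl]
  split_ifs <;> simp_all

end LastEntry

theorem IsFirstMartErr.memLp {δ : ℝ≥0} {X : GenFunctional N} {e : (Fin N → ℝ) → ℝ}
    (he : IsFirstMartErr δ X e) : MemLp e 2 (wienerMeasure N δ) := by
  obtain ⟨f, Y, hf, hY, hfe⟩ := he
  refine ((hf.1.sub (memLp_const _)).sub (memLp_finsetSum _ fun l _ => ?_)).ae_eq hfe.symm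
  exact memLp_mul_apply ((hY l).measurable_coordSigma_compl le_rfl) (hY l).2.1

theorem integral_hermiteProd {δ : ℝ≥0} (hδ : δ ≠ 0) (k : Fin N → ℕ) :
    ∫ x, MvPolynomial.eval x (hermiteProd δ k) ∂wienerMeasure N δ = if k = 0 then 1 else 0 := by
  simpa [hermiteProd_zero] using integral_hermiteProd_mul_hermiteProd hδ k 0

theorem IsFirstMartErr.integral_mul_hermiteProd {δ : ℝ≥0} (hδ : δ ≠ 0) {X : GenFunctional N}
    {e : (Fin N → ℝ) → ℝ} (he : IsFirstMartErr δ X e) (k : Fin N → ℕ) :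
    ∫ x, e x * MvPolynomial.eval x (hermiteProd δ k) ∂wienerMeasure N δ =
      if IsErrIndex k then X (hermiteProd δ k) else 0 := by
  obtain ⟨f, Y, hf, hY, hfe⟩ := he
  have h_herm := memLp_eval δ (hermiteProd δ k)
  have h_int_f : Integrable (fun x => f x * MvPolynomial.eval x (hermiteProd δ k))
      (wienerMeasure N δ) := hf.1.integrable_mul h_herm
  have h_int_const : Integrable (fun x => expect X * MvPolynomial.eval x (hermiteProd δ k))
      (wienerMeasure N δ) := (integrable_eval δ _).const_mul _
  have h_int_Y (l : Fin N) : Integrable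
      (fun x => Y l x * x l * MvPolynomial.eval x (hermiteProd δ k)) (wienerMeasure N δ) :=
    (memLp_mul_apply ((hY l).measurable_coordSigma_compl le_rfl)
      (hY l).2.1).integrable_mul h_herm
  have h_const : expect X * (if k = 0 then 1 else 0) =
      if k = 0 then X (hermiteProd δ k) else 0 := by
    split_ifs with hk
    · rw [hk, hermiteProd_zero, mul_one, expect]
    · rw [mul_zero]
  calc ∫ x, e x * MvPolynomial.eval x (hermiteProd δ k) ∂wienerMeasure N δ
      = ∫ x, (f x * MvPolynomial.eval x (hermiteProd δ k) -
          expect X * MvPolynomial.eval x (hermiteProd δ k) -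
          ∑ l, Y l x * x l * MvPolynomial.eval x (hermiteProd δ k)) ∂wienerMeasure N δ := by
        refine integral_congr_ae ?_
        filter_upwards [hfe] with x hx
        rw [hx, sub_mul, sub_mul, Finset.sum_mul]
    _ = X (hermiteProd δ k) - (if k = 0 then X (hermiteProd δ k) else 0) -
          ∑ l, (if k l = 1 ∧ ∀ i, l < i → k i = 0 then X (hermiteProd δ k) else 0) := by
        refine (integral_sub (h_int_f.sub h_int_const)
          (integrable_finsetSum _ fun l _ => h_int_Y l)).trans ?_
        rw [integral_sub' h_int_f h_int_const, integral_finsetSum _ fun l _ => h_int_Y l,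
          integral_const_mul, integral_hermiteProd hδ, h_const, ← hf.2]
        simp_rw [(hY _).integral_mul_apply_mul_hermiteProd hδ k]
    -- `convert` reconciles two decidability instances for `k l = 1 ∧ ∀ i, l < i → k i = 0`.
    _ = _ := by convert sub_ite_sub_sum_ite_last_eq_one k _

theorem IsFirstMartErr.hasSum_sq {δ : ℝ≥0} (hδ : δ ≠ 0) {X : GenFunctional N}
    {e : (Fin N → ℝ) → ℝ} (he : IsFirstMartErr δ X e) :
    HasSum (fun k => if IsErrIndex k then X (hermiteProd δ k) ^ 2 else 0)
      (∫ x, e x ^ 2 ∂wienerMeasure N δ) := by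
  simpa only [he.integral_mul_hermiteProd hδ, ite_pow, zero_pow two_ne_zero] using
    hasSum_sq_integral_mul_hermiteProd hδ he.memLp

/-! ### Existence of the error -/

theorem exists_isRepresentedBy {δ : ℝ≥0} (hδ : δ ≠ 0) {X : GenFunctional N}
    (hX : Summable fun k => X (hermiteProd δ k) ^ 2) : ∃ f, IsRepresentedBy δ X f := by
  obtain ⟨f, hf, hf_coeff⟩ := exists_memLp_of_summable_sq hδ hX
  exact ⟨f, hf, fun P => eq_integral_mul_eval_of_mem_supported (s := Set.univ) hδ hf
    (fun k _ => (hf_coeff k).symm) (by simp)⟩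

theorem exists_isCondExpPast {δ : ℝ≥0} (hδ : δ ≠ 0) {X : GenFunctional N}
    (hX : Summable fun k => X (hermiteProd δ k) ^ 2) (l : Fin N) :
    ∃ Y, IsCondExpPast δ (partialDeriv δ l X) l Y := by
  have h_summable : Summable fun k : Fin N → ℕ =>
      (if k l = 0 then partialDeriv δ l X (hermiteProd δ k) else 0) ^ 2 := by
    refine Summable.of_nonneg_of_le (fun k => sq_nonneg _) (fun k => ?_)
      ((hX.comp_injective (add_left_injective (Pi.single l 1))).mul_left ((δ : ℝ)⁻¹))
    split_ifs with hk
    · rw [partialDeriv_hermiteProd, hk, ← inv_sqrt_mul_inv_sqrt]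
      simp only [Nat.cast_zero, zero_add, Real.sqrt_one, Function.comp_apply]
      exact le_of_eq (by ring)
    · rw [zero_pow two_ne_zero]
      exact mul_nonneg (inv_nonneg.2 δ.coe_nonneg) (sq_nonneg _)
  obtain ⟨g, hg, hg_coeff⟩ := exists_memLp_of_summable_sq hδ h_summable
  have h_le : pastSigma l ≤ MeasurableSpace.pi :=
    (pastSigma_eq_coordSigma l).trans_le (coordSigma_le_pi _)
  refine ⟨(wienerMeasure N δ)[g | pastSigma l], stronglyMeasurable_condExp.measurable,
    hg.condExp one_le_two, fun P hP => ?_⟩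
  have h_meas : StronglyMeasurable[pastSigma l] fun x => MvPolynomial.eval x P := by
    rw [pastSigma_eq_coordSigma]
    exact (measurable_eval_of_mem_supported hP).stronglyMeasurable
  calc partialDeriv δ l X P = ∫ x, g x * MvPolynomial.eval x P ∂wienerMeasure N δ := by
        refine eq_integral_mul_eval_of_mem_supported hδ hg (fun k hk => ?_) hP
        rw [hg_coeff, if_pos (Function.support_subset_iff'.1 hk l (lt_irrefl l))]
    _ = ∫ x, ((wienerMeasure N δ)[g * fun x => MvPolynomial.eval x P | pastSigma l]) x
          ∂wienerMeasure N δ := (integral_condExp h_le).symm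
    _ = _ := integral_congr_ae (condExp_mul_of_stronglyMeasurable_right h_meas
        (hg.integrable_mul (memLp_eval δ P)) (hg.integrable one_le_two))

theorem exists_isFirstMartErr {δ : ℝ≥0} (hδ : δ ≠ 0) {X : GenFunctional N}
    (hX : Summable fun k => X (hermiteProd δ k) ^ 2) : ∃ e, IsFirstMartErr δ X e := by
  obtain ⟨f, hf⟩ := exists_isRepresentedBy hδ hX
  choose Y hY using exists_isCondExpPast hδ hX
  exact ⟨_, f, Y, hf, hY, ae_eq_rfl⟩

/-! ### Counting the error indices -/

section Counting

variable {ι : Type*}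

theorem succ_mul_multinomial_add_single [DecidableEq ι] {s : Finset ι} {l : ι} (hl : l ∈ s)
    (k : ι → ℕ) :
    (k l + 1) * Nat.multinomial s (k + Pi.single l 1) =
      (∑ i ∈ s, k i + 1) * Nat.multinomial s k := by
  obtain ⟨t, hlt, rfl⟩ : ∃ t, l ∉ t ∧ insert l t = s :=
    ⟨s.erase l, s.notMem_erase l, Finset.insert_erase hl⟩
  have h_eq (i) (hi : i ∈ t) : (k + Pi.single l 1 : ι → ℕ) i = k i := by
    simp [ne_of_mem_of_not_mem hi hlt]
  rw [Nat.multinomial_insert hlt, Nat.multinomial_insert hlt, Nat.multinomial_congr h_eq,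
    Finset.sum_congr rfl h_eq, Finset.sum_insert hlt, Pi.add_apply, Pi.single_eq_same,
    add_right_comm, ← mul_assoc, ← mul_assoc, mul_comm (k l + 1),
    ← Nat.add_one_mul_choose_eq]

theorem multinomial_add_single_le [DecidableEq ι] {s : Finset ι} {l : ι} (hl : l ∈ s)
    (k : ι → ℕ) :
    Nat.multinomial s (k + Pi.single l 1) ≤ (∑ i ∈ s, k i + 1) * Nat.multinomial s k :=
  (Nat.le_mul_of_pos_left _ (k l).succ_pos).trans (succ_mul_multinomial_add_single hl k).le

theorem sum_multinomial_piAntidiag [DecidableEq ι] (s : Finset ι) (n : ℕ) :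
    ∑ k ∈ s.piAntidiag n, Nat.multinomial s k = s.card ^ n := by
  simpa using (Finset.sum_pow_eq_sum_piAntidiag s (fun _ => (1 : ℕ)) n).symm

theorem IsErrIndex.two_le_sum [LinearOrder ι] [Fintype ι] {k : ι → ℕ} (hk : IsErrIndex k) :
    2 ≤ ∑ i, k i := by
  obtain ⟨l, hl, -⟩ := hk
  exact hl.trans (Finset.single_le_sum (fun _ _ => Nat.zero_le _) (Finset.mem_univ l))

/-- The multi-index `k` with its last nonzero entry increased by one, and `0` for `k = 0`. Every
error index arises in this way. -/
def raiseLast [LinearOrder ι] [Fintype ι] (k : ι → ℕ) : ι → ℕ :=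
  if hk : k ≠ 0 then k + Pi.single (existsUnique_last_ne_zero hk).choose 1 else 0

theorem multinomial_raiseLast_le [LinearOrder ι] [Fintype ι] (k : ι → ℕ) :
    Nat.multinomial Finset.univ (raiseLast k) ≤ (∑ i, k i + 1) * Nat.multinomial Finset.univ k := by
  unfold raiseLast
  split_ifs with hk
  · exact multinomial_add_single_le (Finset.mem_univ _) k
  · simp [not_not.1 hk]

theorem IsErrIndex.exists_raiseLast_eq [LinearOrder ι] [Fintype ι] {k : ι → ℕ}
    (hk : IsErrIndex k) : ∃ j, ∑ i, j i + 1 = ∑ i, k i ∧ raiseLast j = k := by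
  obtain ⟨l, hl, hl_last⟩ := hk
  have h_add : k - Pi.single l 1 + Pi.single l 1 = k :=
    sub_single_add_single (by omega)
  have h_last : (k - Pi.single l 1 : ι → ℕ) l ≠ 0 ∧
      ∀ i, l < i → (k - Pi.single l 1 : ι → ℕ) i = 0 :=
    ⟨by simp; omega, fun i hi => by simp [hl_last i hi]⟩
  have h_ne : k - Pi.single l 1 ≠ 0 := fun h => h_last.1 (congrFun h l)
  refine ⟨k - Pi.single l 1, ?_, ?_⟩
  · conv_rhs => rw [← h_add]
    simp [Finset.sum_add_distrib]
  · have h_exists := existsUnique_last_ne_zero h_ne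
    rw [raiseLast, dif_pos h_ne, h_exists.unique h_exists.choose_spec.1 h_last, h_add]

theorem sum_multinomial_isErrIndex_le [LinearOrder ι] [Fintype ι] (m : ℕ) :
    ∑ k ∈ Finset.piAntidiag (Finset.univ : Finset ι) (m + 1) with IsErrIndex k,
      Nat.multinomial Finset.univ k ≤ (m + 1) * Fintype.card ι ^ m := by
  have h_subset : (Finset.piAntidiag (Finset.univ : Finset ι) (m + 1)).filter IsErrIndex ⊆
      (Finset.piAntidiag Finset.univ m).image raiseLast := by
    intro k hk
    obtain ⟨hk_deg, hk_err⟩ := Finset.mem_filter.1 hk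
    obtain ⟨j, hj, rfl⟩ := hk_err.exists_raiseLast_eq
    rw [(Finset.mem_piAntidiag.1 hk_deg).1] at hj
    exact Finset.mem_image_of_mem _ (by simpa using hj)
  calc _ ≤ ∑ k ∈ (Finset.piAntidiag (Finset.univ : Finset ι) m).image raiseLast,
        Nat.multinomial Finset.univ k := Finset.sum_le_sum_of_subset h_subset
    _ ≤ ∑ k ∈ Finset.piAntidiag (Finset.univ : Finset ι) m,
        Nat.multinomial Finset.univ (raiseLast k) :=
        Finset.sum_image_le_of_nonneg fun _ _ => Nat.zero_le _
    _ ≤ ∑ k ∈ Finset.piAntidiag (Finset.univ : Finset ι) m,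
        (m + 1) * Nat.multinomial Finset.univ k := by
        refine Finset.sum_le_sum fun k hk => (multinomial_raiseLast_le k).trans_eq ?_
        rw [(Finset.mem_piAntidiag.1 hk).1]
    _ = (m + 1) * Fintype.card ι ^ m := by
        rw [← Finset.mul_sum, sum_multinomial_piAntidiag, Finset.card_univ]

end Counting

/-! ### The error bound -/

theorem tsum_eq_tsum_sum_piAntidiag {ι : Type*} [Fintype ι] [DecidableEq ι]
    (g : (ι → ℕ) → ℝ≥0∞) : ∑' k, g k = ∑' n, ∑ k ∈ Finset.piAntidiag Finset.univ n, g k := by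
  rw [← ENNReal.tsum_fiberwise g fun k => ∑ i, k i]
  refine tsum_congr fun n => ?_
  have h_fiber : (fun k : ι → ℕ => ∑ i, k i) ⁻¹' {n} =
      (Finset.piAntidiag Finset.univ n : Finset (ι → ℕ)) := by
    ext k
    simp
  rw [h_fiber]
  exact Finset.tsum_subtype _ g

theorem chaosNormSq_nonneg (δ : ℝ≥0) (n : ℕ) (X : GenFunctional N) : 0 ≤ chaosNormSq δ n X :=
  integral_nonneg fun _ => sq_nonneg _

theorem summable_sq_of_sobolevNormSq_ne_top {δ : ℝ≥0} (hδ : δ ≠ 0) {s : ℝ} (hs : 0 ≤ s)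
    {X : GenFunctional N} (hX : sobolevNormSq δ s X ≠ ∞) :
    Summable fun k => X (hermiteProd δ k) ^ 2 := by
  suffices h : ∑' k, ENNReal.ofReal (X (hermiteProd δ k) ^ 2) ≠ ∞ by
    simpa [ENNReal.toReal_ofReal, sq_nonneg] using ENNReal.summable_toReal h
  refine ne_top_of_le_ne_top hX ?_
  rw [tsum_eq_tsum_sum_piAntidiag]
  refine ENNReal.tsum_le_tsum fun n => ?_
  rw [← ENNReal.ofReal_sum_of_nonneg fun _ _ => sq_nonneg _, ← chaosNormSq_eq_sum_sq hδ]
  exact ENNReal.ofReal_le_ofReal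
    (le_mul_of_one_le_left (chaosNormSq_nonneg _ _ _) (Real.one_le_rpow (by simp) hs))

/-- The squared norm of the component of the first order error in the `n`-th chaos. -/
def errChaosNormSq (δ : ℝ≥0) (n : ℕ) (X : GenFunctional N) : ℝ :=
  ∑ k ∈ Finset.piAntidiag (Finset.univ : Finset (Fin N)) n with IsErrIndex k,
    X (hermiteProd δ k) ^ 2

theorem errChaosNormSq_le_chaosNormSq {δ : ℝ≥0} (hδ : δ ≠ 0) (n : ℕ) (X : GenFunctional N) :
    errChaosNormSq δ n X ≤ chaosNormSq δ n X := by
  rw [chaosNormSq_eq_sum_sq hδ]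
  exact Finset.sum_le_sum_of_subset_of_nonneg (Finset.filter_subset _ _) fun _ _ _ => sq_nonneg _

theorem errChaosNormSq_of_lt_two (δ : ℝ≥0) {n : ℕ} (hn : n < 2) (X : GenFunctional N) :
    errChaosNormSq δ n X = 0 := by
  rw [errChaosNormSq, Finset.filter_false_of_mem, Finset.sum_empty]
  intro k hk hk_err
  rw [← (Finset.mem_piAntidiag.1 hk).1] at hn
  exact hn.not_ge hk_err.two_le_sum

theorem IsFirstMartErr.ofReal_integral_sq {δ : ℝ≥0} (hδ : δ ≠ 0) {X : GenFunctional N}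
    {e : (Fin N → ℝ) → ℝ} (he : IsFirstMartErr δ X e) :
    ENNReal.ofReal (∫ x, e x ^ 2 ∂wienerMeasure N δ) =
      ∑' n, ENNReal.ofReal (errChaosNormSq δ n X) := by
  have h_sum := he.hasSum_sq hδ
  have h_nonneg (k : Fin N → ℕ) : 0 ≤ if IsErrIndex k then X (hermiteProd δ k) ^ 2 else 0 := by
    positivity
  rw [← h_sum.tsum_eq, ENNReal.ofReal_tsum_of_nonneg h_nonneg h_sum.summable,
    tsum_eq_tsum_sum_piAntidiag]
  refine tsum_congr fun n => ?_
  rw [← ENNReal.ofReal_sum_of_nonneg fun k _ => h_nonneg k, errChaosNormSq, Finset.sum_filter]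

theorem IsFirstMartErr.integral_sq_le {δ : ℝ≥0} (hδ : δ ≠ 0) {X : GenFunctional N}
    {e : (Fin N → ℝ) → ℝ} (he : IsFirstMartErr δ X e) {s B : ℝ} (hB : 0 ≤ B) {M : ℝ≥0}
    (hM : sobolevNormSq δ s X ≤ M)
    (h_err : ∀ n : ℕ, errChaosNormSq δ n X ≤ B * ((1 + (n : ℝ)) ^ s * chaosNormSq δ n X)) :
    ∫ x, e x ^ 2 ∂wienerMeasure N δ ≤ B * M := by
  rw [← ENNReal.ofReal_le_ofReal_iff (by positivity)]
  calc ENNReal.ofReal (∫ x, e x ^ 2 ∂wienerMeasure N δ)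
      = ∑' n, ENNReal.ofReal (errChaosNormSq δ n X) := he.ofReal_integral_sq hδ
    _ ≤ ∑' n : ℕ, ENNReal.ofReal B * ENNReal.ofReal ((1 + (n : ℝ)) ^ s * chaosNormSq δ n X) := by
        refine ENNReal.tsum_le_tsum fun n => ?_
        rw [← ENNReal.ofReal_mul hB]
        exact ENNReal.ofReal_le_ofReal (h_err n)
    _ = ENNReal.ofReal B * sobolevNormSq δ s X := ENNReal.tsum_mul_left
    _ ≤ ENNReal.ofReal B * M := by gcongr
    _ = ENNReal.ofReal (B * M) := by rw [ENNReal.ofReal_mul hB, ENNReal.ofReal_coe_nnreal]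

theorem sq_apply_hermiteProd_le {T : ℝ≥0} (hT : T ≠ 0) (hN : N ≠ 0) {X : GenFunctional N}
    {k : Fin N → ℕ} {n : ℕ} (hk : ∑ i, k i = n) {C c : ℝ}
    (h : expect (mixedDeriv (T / N) k X) ^ 2 ≤ C * ((n.factorial : ℝ) * c / (T : ℝ) ^ n)) :
    X (hermiteProd (T / N) k) ^ 2 ≤ C * c / (N : ℝ) ^ n * Nat.multinomial Finset.univ k := by
  have hT' : (0 : ℝ) < T := by exact_mod_cast pos_of_ne_zero hT
  have hN' : (0 : ℝ) < N := by exact_mod_cast pos_of_ne_zero hN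
  have h_spec : (∏ i, ((k i).factorial : ℝ)) * Nat.multinomial Finset.univ k = n.factorial := by
    exact_mod_cast hk ▸ Nat.multinomial_spec Finset.univ k
  have h_pos : (0 : ℝ) < (∏ i, ((k i).factorial : ℝ)) * (N / T : ℝ) ^ n := by positivity
  rw [sq_expect_mixedDeriv, hk, NNReal.coe_div, NNReal.coe_natCast, inv_div, ← h_spec] at h
  refine le_of_mul_le_mul_left (h.trans_eq ?_) h_pos
  rw [div_pow]
  field_simp

theorem errChaosNormSq_succ_le {δ : ℝ≥0} {X : GenFunctional N} {m : ℕ} {a : ℝ} (ha : 0 ≤ a)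
    (h : ∀ k : Fin N → ℕ, ∑ i, k i = m + 1 →
      X (hermiteProd δ k) ^ 2 ≤ a * Nat.multinomial Finset.univ k) :
    errChaosNormSq δ (m + 1) X ≤ a * ((m + 1) * N ^ m) := by
  have h_count := sum_multinomial_isErrIndex_le (ι := Fin N) m
  rw [Fintype.card_fin] at h_count
  calc errChaosNormSq δ (m + 1) X
      ≤ ∑ k ∈ Finset.piAntidiag (Finset.univ : Finset (Fin N)) (m + 1) with IsErrIndex k,
          a * Nat.multinomial Finset.univ k :=
        Finset.sum_le_sum fun k hk =>
          h k (Finset.mem_piAntidiag.1 (Finset.mem_filter.1 hk).1).1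
    _ ≤ a * ((m + 1) * N ^ m) := by
        rw [← Finset.mul_sum]
        gcongr
        exact_mod_cast h_count

theorem errChaosNormSq_le_of_sq_expect_le {T : ℝ≥0} (hT : T ≠ 0) (hN : N ≠ 0)
    {X : GenFunctional N} {n : ℕ} (hn : n ≠ 0) {C : ℝ} (hC : 0 ≤ C)
    (h : ∀ k : Fin N → ℕ, ∑ i, k i = n → expect (mixedDeriv (T / N) k X) ^ 2 ≤
      C * ((n.factorial : ℝ) * chaosNormSq (T / N) n X / (T : ℝ) ^ n)) :
    errChaosNormSq (T / N) n X ≤ C * (n / N) * chaosNormSq (T / N) n X := by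
  obtain ⟨m, rfl⟩ := Nat.exists_eq_succ_of_ne_zero hn
  have h_nonneg := chaosNormSq_nonneg (T / N) (m + 1) X
  refine (errChaosNormSq_succ_le (by positivity)
    fun k hk => sq_apply_hermiteProd_le hT hN hk (h k hk)).trans_eq ?_
  have hN' : (N : ℝ) ≠ 0 := by exact_mod_cast hN
  rw [Nat.succ_eq_add_one, pow_succ]
  push_cast
  field_simp

theorem FiniteDimensionalProperty.exists_errChaosNormSq_le {T : ℝ≥0} (hT : T ≠ 0)
    {F : (N : ℕ+) → GenFunctional (N : ℕ)} (hF : FiniteDimensionalProperty T F) :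
    ∃ B : ℝ, 1 ≤ B ∧ ∀ (N : ℕ+) (n : ℕ), errChaosNormSq (T / (N : ℕ)) n (F N) ≤
      B * ((1 + (n : ℝ)) / (N : ℕ)) * chaosNormSq (T / (N : ℕ)) n (F N) := by
  obtain ⟨C, hC⟩ := hF
  obtain ⟨N₀, hN₀⟩ := Filter.eventually_atTop.1 hC
  have h_one : (1 : ℝ) ≤ max C N₀ := le_max_of_le_right (Nat.one_le_cast.2 N₀.pos)
  refine ⟨max C N₀, h_one, fun N n => ?_⟩
  have hN : (0 : ℝ) < (N : ℕ) := by exact_mod_cast N.pos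
  have h_nonneg := chaosNormSq_nonneg (T / (N : ℕ)) n (F N)
  obtain hn | hn := lt_or_ge n 2
  · rw [errChaosNormSq_of_lt_two _ hn]
    positivity
  obtain h_ge | h_lt := le_or_gt N₀ N
  · calc errChaosNormSq (T / (N : ℕ)) n (F N)
        ≤ max C N₀ * (n / (N : ℕ)) * chaosNormSq (T / (N : ℕ)) n (F N) := by
          refine errChaosNormSq_le_of_sq_expect_le hT N.ne_zero (by omega) (by positivity)
            fun k hk => (hN₀ N h_ge n hn k hk).trans ?_
          gcongr
          exact le_max_left _ _
      _ ≤ _ := by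
          gcongr
          linarith
  · have h_one_le : 1 ≤ max C N₀ * ((1 + (n : ℝ)) / (N : ℕ)) := by
      have h_le : ((N : ℕ) : ℝ) ≤ max C N₀ := le_max_of_le_right (by exact_mod_cast h_lt.le)
      rw [← mul_div_assoc, one_le_div hN]
      exact h_le.trans (le_mul_of_one_le_right (by positivity) (by simp))
    exact (errChaosNormSq_le_chaosNormSq (div_ne_zero hT (by simp)) n _).trans
      (le_mul_of_one_le_left h_nonneg h_one_le)

theorem le_mul_rpow_mul_of_le_of_le {a c B y s : ℝ} (hc : 0 ≤ c) (hB : 1 ≤ B) (hy : 0 ≤ y)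
    (hs0 : 0 ≤ s) (hs1 : s ≤ 1) (h_le : a ≤ c) (h_le_mul : a ≤ B * y * c) :
    a ≤ B * y ^ s * c := by
  obtain h | h := le_total 1 y
  · exact h_le.trans (le_mul_of_one_le_left hc
      (one_le_mul_of_one_le_of_one_le hB (Real.one_le_rpow h hs0)))
  · refine h_le_mul.trans ?_
    gcongr
    exact Real.self_le_rpow_of_le_one hy h hs1

theorem FiniteDimensionalProperty.exists_errChaosNormSq_le_rpow {T : ℝ≥0} (hT : T ≠ 0)
    {F : (N : ℕ+) → GenFunctional (N : ℕ)} (hF : FiniteDimensionalProperty T F) {s : ℝ}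
    (hs0 : 0 ≤ s) (hs1 : s ≤ 1) :
    ∃ B : ℝ, 0 ≤ B ∧ ∀ (N : ℕ+) (n : ℕ), errChaosNormSq (T / (N : ℕ)) n (F N) ≤
      B * (N : ℝ) ^ (-s) * ((1 + (n : ℝ)) ^ s * chaosNormSq (T / (N : ℕ)) n (F N)) := by
  obtain ⟨B, hB, h_err⟩ := hF.exists_errChaosNormSq_le hT
  refine ⟨B, by linarith, fun N n => (le_mul_rpow_mul_of_le_of_le (chaosNormSq_nonneg _ _ _) hB
    (by positivity) hs0 hs1 (errChaosNormSq_le_chaosNormSq (div_ne_zero hT (by simp)) n _)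
    (h_err N n)).trans_eq ?_⟩
  rw [Real.div_rpow (by positivity) (by positivity), Real.rpow_neg (by positivity)]
  ring

end

end DiscreteWiener

open DiscreteWiener in
theorem theorem3p4 (T : ℝ≥0) (hT : 0 < T) (s : ℝ) (hs0 : 0 ≤ s) (hs1 : s ≤ 1)
    (F : (N : ℕ+) → DiscreteWiener.GenFunctional (N : ℕ))
    (hF : ∀ N : ℕ+, F N ∈ DiscreteWiener.sobolevSpaceNegInf (N : ℕ) (T / (N : ℕ)))
    (hbdd : ∃ M : ℝ≥0, ∀ N : ℕ+, DiscreteWiener.sobolevNormSq (T / (N : ℕ)) s (F N) ≤ M)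
    (hfdp : DiscreteWiener.FiniteDimensionalProperty T F) :
    ∃ C : ℝ, ∀ N : ℕ+,
      (∃ e, DiscreteWiener.IsFirstMartErr (T / (N : ℕ)) (F N) e) ∧
      ∀ e, DiscreteWiener.IsFirstMartErr (T / (N : ℕ)) (F N) e →
        MemLp e 2 (DiscreteWiener.wienerMeasure (N : ℕ) (T / (N : ℕ))) ∧
        ∫ x, e x ^ 2 ∂DiscreteWiener.wienerMeasure (N : ℕ) (T / (N : ℕ)) ≤
          C * (N : ℝ) ^ (-s) := by
  obtain ⟨M, hM⟩ := hbdd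
  obtain ⟨B, hB, h_err⟩ := hfdp.exists_errChaosNormSq_le_rpow hT.ne' hs0 hs1
  refine ⟨B * M, fun N => ?_⟩
  have hδ : T / ((N : ℕ) : ℝ≥0) ≠ 0 := div_ne_zero hT.ne' (by simp)
  have h_summable : Summable fun k => F N (hermiteProd (T / (N : ℕ)) k) ^ 2 :=
    summable_sq_of_sobolevNormSq_ne_top hδ hs0 (ne_top_of_le_ne_top ENNReal.coe_ne_top (hM N))
  refine ⟨exists_isFirstMartErr hδ h_summable, fun e he => ⟨he.memLp, ?_⟩⟩
  rw [mul_right_comm]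
  exact he.integral_sq_le hδ (by positivity) (hM N) (h_err N)
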